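/- Let $n\ge 6$ and let $X(E_n)$ be the graph with vertices $0,1,\dots,n-1$ in which $1,2,\dots,n-1$ form a path in this order and $0$ is joined to $3$ only. Let $W=W(E_n)$ be the corresponding Coxeter group, with generators $s_0,\dots,s_{n-1}$, with $m(s_i,s_j)=3$ if $i,j$ are adjacent and $m(s_i,s_j)=2$ if $i\ne j$ are not adjacent, and with length function $\ell$; a product $w_1\cdots w_k$ in $W$ is called reduced if $\ell(w_1\cdots w_k)=\sum_i \ell(w_i)$. Call $w\in W$ fully commutative if it cannot be written as a reduced product $x_1\,(s_is_js_i)\,x_2$ with $i,j$ adjacent. For a set $A$ of pairwise non-adjacent vertices let $i(A)=\prod_{i\in A}s_i$. Fan's $\mathbf a$-function is $$\mathbf a(w)=\max\{\#A : A \text{ a set of pairwise non-adjacent vertices},\ w=x\,i(A)\,y \text{ reduced for some } x,y\in W\}.$$ Let $\mathcal A=\mathbb Z[v,v^{-1}]$, $\delta=v+v^{-1}$, and let $TL(E_n)$ be the unital associative $\mathcal A$-algebra with generators $b_0,\dots,b_{n-1}$ and relations $b_i^2=\delta b_i$; $b_ib_j=b_jb_i$ if $m(s_i,s_j)=2$;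 $b_ib_jb_i=b_i$ if $m(s_i,s_j)=3$. For fully commutative $w$ with reduced expression $w=s_{i_1}\cdots s_{i_r}$ put $b_w=b_{i_1}\cdots b_{i_r}$. Let $K$ be a field containing $\mathcal A$ and let $TL_K(E_n)=K\otimes_{\mathcal A}TL(E_n)$. There is a unique $K$-linear map $\mathrm{tr}:TL_K(E_n)\to K$ such that $\mathrm{tr}(xy)=\mathrm{tr}(yx)$ for all $x,y$ and $\mathrm{tr}(b_{i(A)})=\delta^{-\#A}$ for every set $A$ of pairwise non-adjacent vertices. Moreover, for every fully commutative $w\in W$ there is an integer $a$ such that $\mathrm{tr}(b_w)=\delta^{a}$ (for every choice of reduced expression of $w$ in the definition of $b_w$), where $a=-\mathbf a(w)$ if $w^2=1$, and $a<-\mathbf a(w)$ otherwise. -/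

import Mathlib

open scoped TensorProduct LaurentPolynomial

noncomputable section

namespace TypeE

/-- Adjacency in the Coxeter graph of type `E n` on the vertices `0, 1, …, n - 1`: the vertices
`1, 2, …, n - 1` form a path in this order, and `0` is joined to `3` only. -/
def Adj (n : ℕ) (i j : Fin n) : Prop :=
  (1 ≤ i.val ∧ j.val = i.val + 1) ∨ (1 ≤ j.val ∧ i.val = j.val + 1) ∨
    (i.val = 0 ∧ j.val = 3) ∨ (i.val = 3 ∧ j.val = 0)

theorem Adj.symm {n : ℕ} {i j : Fin n} (h : Adj n i j) : Adj n j i := by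
  unfold Adj at *; tauto

theorem Adj.ne {n : ℕ} {i j : Fin n} (h : Adj n i j) : i ≠ j := by
  rintro rfl; unfold Adj at h; omega

open Classical in
/-- The Coxeter matrix of type `E n`: `m(s, s) = 1`, `m(s, t) = 3` if `s` and `t` are adjacent in
the graph, and `m(s, t) = 2` otherwise. -/
def coxeterMatrix (n : ℕ) : CoxeterMatrix (Fin n) where
  M := Matrix.of fun i j => if i = j then 1 else if Adj n i j then 3 else 2
  isSymm := by
    refine Matrix.IsSymm.ext fun i j => ?_
    have h : Adj n i j ↔ Adj n j i := ⟨Adj.symm, Adj.symm⟩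
    simp [eq_comm, h]
  diagonal i := by simp
  off_diagonal i j hij := by
    simp only [Matrix.of_apply, if_neg hij]
    split_ifs <;> decide

/-- The Coxeter group `W(E n)`. -/
abbrev W (n : ℕ) : Type := (coxeterMatrix n).Group

/-- The Coxeter system `(W(E n), S(E n))`; its generators are `(cs n).simple i` for `i : Fin n`. -/
abbrev cs (n : ℕ) : CoxeterSystem (coxeterMatrix n) (W n) := (coxeterMatrix n).toCoxeterSystem

/-- `w` is complex if it is a reduced product `x₁ · w_{st} · x₂`, where `w_{st} = sts` is the longest
element of the parabolic subgroup `⟨s, t⟩` (of length `3`) for two adjacent vertices `s, t`. -/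
def IsComplex (n : ℕ) (w : W n) : Prop :=
  ∃ (x₁ x₂ : W n) (i j : Fin n), Adj n i j ∧
    w = x₁ * ((cs n).simple i * (cs n).simple j * (cs n).simple i) * x₂ ∧
    (cs n).length w = (cs n).length x₁ +
      (cs n).length ((cs n).simple i * (cs n).simple j * (cs n).simple i) + (cs n).length x₂

/-- The fully commutative elements: those which are not complex. -/
def IsFullyCommutative (n : ℕ) (w : W n) : Prop := ¬ IsComplex n w

/-- `ω` is (the list of labels of) a reduced expression for `w`. -/
def IsReducedExpression (n : ℕ) (ω : List (Fin n)) (w : W n) : Prop :=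
  (cs n).IsReduced ω ∧ (cs n).wordProd ω = w

/-- `A` is a set of pairwise non-adjacent vertices of the Coxeter graph. -/
def IsIndependent (n : ℕ) (A : Finset (Fin n)) : Prop :=
  ∀ i ∈ A, ∀ j ∈ A, ¬ Adj n i j

/-- A word listing each vertex in `A` once. For independent `A` the order does not matter in the
products below, as the corresponding generators commute; we take the increasing one. -/
def wordOf (n : ℕ) (A : Finset (Fin n)) : List (Fin n) := A.sort (· ≤ ·)

/-- The element `i(A)` of the Coxeter group, the product of the generators in `A`. -/
def prodOf (n : ℕ) (A : Finset (Fin n)) : W n := (cs n).wordProd (wordOf n A)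

/-- The cardinalities of the independent sets `A` such that `w = x i(A) y` is a reduced product for
some `x, y`. -/
def aSet (n : ℕ) (w : W n) : Set ℕ :=
  {k | ∃ (A : Finset (Fin n)) (x y : W n), IsIndependent n A ∧ A.card = k ∧
    w = x * prodOf n A * y ∧
    (cs n).length w = (cs n).length x + (cs n).length (prodOf n A) + (cs n).length y}

/-- Fan's `a`-function: `a(w) = max {#A : A independent, w = x i(A) y reduced}`. -/
def aFun (n : ℕ) (w : W n) : ℕ := sSup (aSet n w)

/-- The supremum in the definition of the `a`-function is a maximum. -/
theorem aFun_isGreatest (n : ℕ) (w : W n) : IsGreatest (aSet n w) (aFun n w) := by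
  have hb : BddAbove (aSet n w) := by
    refine ⟨n, ?_⟩
    rintro k ⟨A, x, y, -, rfl, -⟩
    simpa using A.card_le_univ
  have hne : (aSet n w).Nonempty := by
    refine ⟨0, ∅, w, 1, ?_, ?_, ?_, ?_⟩ <;> simp [IsIndependent, prodOf, wordOf]
  exact ⟨Nat.sSup_mem hne hb, fun k hk => le_csSup hb hk⟩

/-- The Laurent polynomial `δ = v + v⁻¹` in `ℤ[v, v⁻¹]`. -/
def delta : ℤ[T;T⁻¹] := LaurentPolynomial.T 1 + LaurentPolynomial.T (-1)

/-- The defining relations of the generalized Temperley–Lieb algebra of type `E n`: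
`b_s² = δ b_s`, `b_s b_t = b_t b_s` if `m(s, t) = 2`, `b_s b_t b_s = b_s` if `m(s, t) = 3`. -/
inductive TLRel (n : ℕ) : FreeAlgebra ℤ[T;T⁻¹] (Fin n) → FreeAlgebra ℤ[T;T⁻¹] (Fin n) → Prop
  | sq (i : Fin n) :
      TLRel n (FreeAlgebra.ι _ i * FreeAlgebra.ι _ i) (delta • FreeAlgebra.ι _ i)
  | comm (i j : Fin n) (h : coxeterMatrix n i j = 2) :
      TLRel n (FreeAlgebra.ι _ i * FreeAlgebra.ι _ j) (FreeAlgebra.ι _ j * FreeAlgebra.ι _ i)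
  | braid (i j : Fin n) (h : coxeterMatrix n i j = 3) :
      TLRel n (FreeAlgebra.ι _ i * FreeAlgebra.ι _ j * FreeAlgebra.ι _ i) (FreeAlgebra.ι _ i)

/-- The generalized Temperley–Lieb algebra `TL(E n)` over `ℤ[v, v⁻¹]`. -/
abbrev TL (n : ℕ) : Type := RingQuot (TLRel n)

/-- The generator `b_s` of `TL(E n)`. -/
def b (n : ℕ) (i : Fin n) : TL n := RingQuot.mkAlgHom ℤ[T;T⁻¹] (TLRel n) (FreeAlgebra.ι _ i)

/-- The product `b_{i₁} b_{i₂} ⋯ b_{iᵣ}` for a word `i₁ i₂ … iᵣ`. If the word is a reduced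
expression for a fully commutative `w`, this is the monomial basis element `b_w`. -/
def bWord (n : ℕ) (ω : List (Fin n)) : TL n := (ω.map (b n)).prod

variable (K : Type*) [Field K] [Algebra ℤ[T;T⁻¹] K]

/-- The extension of scalars `TL_K(E n) = K ⊗ TL(E n)`. -/
abbrev TLK (n : ℕ) : Type _ := K ⊗[ℤ[T;T⁻¹]] TL n

/-- `δ` as an element of `K`. -/
def deltaK : K := algebraMap ℤ[T;T⁻¹] K delta

/-- The image of `bWord` in `TL_K(E n)`. -/
def bWordK (n : ℕ) (ω : List (Fin n)) : TLK K n := (1 : K) ⊗ₜ[ℤ[T;T⁻¹]] bWord n ω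

variable {K}

/-- A linear map `τ : TL_K(E n) → K` is a trace if `τ(xy) = τ(yx)` for all `x, y`. -/
def IsTrace {n : ℕ} (τ : TLK K n →ₗ[K] K) : Prop := ∀ x y : TLK K n, τ (x * y) = τ (y * x)

/-- `τ` is the trace `tr`: a trace whose value on `i(A)` is `δ ^ (-#A)` for every independent set
`A` of vertices. -/
def IsMarkovTr {n : ℕ} (τ : TLK K n →ₗ[K] K) : Prop :=
  IsTrace τ ∧ ∀ A : Finset (Fin n), IsIndependent n A →
    τ (bWordK K n (wordOf n A)) = deltaK K ^ (-(A.card : ℤ))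

end TypeE

end

/-! ### Gaps in Boolean words -/

section BoolWords

/-! The trace is found at one value of the parameter and then transported to all others. For `δ = 2`
the four-state Potts model gives symmetric real matrices that satisfy the Temperley–Lieb relations
of `E_n` and whose normalized trace on an antichain `A` is `2 ^ (-#A)` (`isTLRep_eMat`).

The combinatorial input is that `r ++ r` is never fully commutative for a nonempty word `r`
(`eq_nil_of_fcWord_append_self`). Consequently every word that is not an antichain can, up to
rotation and commutation, be shortened by a Temperley–Lieb relation (`word_induction`). So the trace
of every word is a power of `2`, and its exponent `traceExp` changes under the relations exactly as
an exponent of `δ` should. Hence `ω ↦ δ ^ traceExp ω` descends to a trace on the algebra, and the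
same induction shows that it is unique.

For the comparison with Fan's function the inner product `⟨M, N⟩ = ntr (Mᵀ N)` is used. The
combinatorial input also makes `E_n` star reducible (`star_reducible`), whence fully commutative
words have norm one (`IsTLRep.ntr_norm`). If `w = x i(A) y` is reduced, then `2 ^ #A` times the
trace of `w` is the inner product of the unit vectors `(x A)ᵀ` and `A y`. By Cauchy–Schwarz the
exponent is at most `-#A`, and equality forces the matrix of `w` to be symmetric
(`IsTLRep.ntr_antichain_le`). A fully commutative word with symmetric matrix is, up to commutations,
`z B z⁻¹` for an antichain `B`, and its trace is `2 ^ (-#B)` (`IsTLRep.exists_palindrome`); in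
particular it represents an involution. Conversely, if `w² = 1`, then reversing a reduced word gives
another reduced word of `w`. The two differ by commutations (`commEq_of_isReduced`, through the
exchange property), so the matrix is symmetric, and the exponent `-#B` is at least `-a(w)`. -/

/-- The number of leading `false`s of a list, increased by `2` if there is no `true` at all. -/
def leadGap : List Bool → ℕ
  | [] => 2
  | true :: _ => 0
  | false :: l => leadGap l + 1

/-- The number of trailing `false`s of a list, increased by `2` if there is no `true` at all. -/
def trailGap (l : List Bool) : ℕ := leadGap l.reverse

/-- Any two successive `true`s are separated by at least two `false`s. -/
def Spaced : List Bool → Prop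
  | [] => True
  | true :: l => 2 ≤ leadGap l ∧ Spaced l
  | false :: l => Spaced l

theorem leadGap_append_of_mem {l : List Bool} (h : true ∈ l) (m : List Bool) :
    leadGap (l ++ m) = leadGap l := by
  induction l with
  | nil => simp at h
  | cons a l ih =>
    cases a
    · simp only [List.mem_cons, Bool.true_eq_false, false_or] at h
      simp [leadGap, ih h]
    · simp [leadGap]

theorem leadGap_append_of_notMem {l : List Bool} (h : true ∉ l) (m : List Bool) :
    leadGap (l ++ m) = l.length + leadGap m := by
  induction l with
  | nil => simp
  | cons a l ih =>
    cases a
    · simp only [List.mem_cons, Bool.true_eq_false, false_or] at h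
      simp [leadGap, ih h]; omega
    · simp at h

theorem leadGap_of_notMem {l : List Bool} (h : true ∉ l) : leadGap l = l.length + 2 := by
  simpa [leadGap] using leadGap_append_of_notMem h []

theorem trailGap_append_of_mem {l : List Bool} (h : true ∈ l) (m : List Bool) :
    trailGap (m ++ l) = trailGap l := by
  simp only [trailGap, List.reverse_append]
  exact leadGap_append_of_mem (by simpa using h) _

theorem trailGap_append_of_notMem {l : List Bool} (h : true ∉ l) (m : List Bool) :
    trailGap (m ++ l) = trailGap m + l.length := by
  simp only [trailGap, List.reverse_append]
  rw [leadGap_append_of_notMem (by simpa using h)]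
  simp [add_comm]

theorem trailGap_of_notMem {l : List Bool} (h : true ∉ l) : trailGap l = l.length + 2 := by
  rw [trailGap, leadGap_of_notMem (by simpa using h)]; simp

theorem leadGap_eq_zero {l : List Bool} : leadGap l = 0 ↔ ∃ m, l = true :: m := by
  rcases l with _ | ⟨_ | _, l⟩ <;> simp [leadGap]

theorem leadGap_eq_one {l : List Bool} : leadGap l = 1 ↔ ∃ m, l = false :: true :: m := by
  rcases l with _ | ⟨_ | _, _ | ⟨_ | _, l⟩⟩ <;> simp [leadGap]

/-- Only the last `true` of `l` and the first `true` of `m` interact. The extra `2` that a gap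
receives when there is no `true` makes the third condition vacuous if one of the two lists has none.
-/
theorem spaced_append {l m : List Bool} :
    Spaced (l ++ m) ↔ Spaced l ∧ Spaced m ∧ 2 ≤ trailGap l + leadGap m := by
  induction l with
  | nil => simp [Spaced, trailGap, leadGap]
  | cons a l ih =>
    have key : true ∈ l → trailGap (a :: l) = trailGap l := fun h =>
      trailGap_append_of_mem h [a]
    have key' : true ∉ l → trailGap (a :: l) = trailGap [a] + l.length := fun h =>
      trailGap_append_of_notMem h [a]
    by_cases h : true ∈ l
    · rw [key h]
      cases a
      · simp only [List.cons_append, Spaced, ih]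
      · simp only [List.cons_append, Spaced, ih, leadGap_append_of_mem h]; tauto
    · rw [key' h]
      cases a
      · simp only [List.cons_append, Spaced, ih, trailGap_of_notMem h]
        simp [trailGap, leadGap]; omega
      · have h3 : trailGap [true] = 0 := rfl
        have h4 := trailGap_of_notMem h
        simp only [List.cons_append, Spaced, ih, leadGap_append_of_notMem h, leadGap_of_notMem h, h3]
        constructor
        · rintro ⟨h5, h6, h7, -⟩
          exact ⟨⟨by omega, h6⟩, h7, by omega⟩
        · rintro ⟨⟨-, h6⟩, h7, h8⟩
          exact ⟨by omega, h6, h7, by omega⟩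

theorem spaced_of_notMem {l : List Bool} (h : true ∉ l) : Spaced l := by
  induction l with
  | nil => trivial
  | cons a l ih => cases a <;> simp_all [Spaced]

theorem spaced_reverse {l : List Bool} : Spaced l.reverse ↔ Spaced l := by
  induction l with
  | nil => simp
  | cons a l ih =>
    rw [List.reverse_cons, spaced_append, ih]
    have : trailGap l.reverse = leadGap l := by simp [trailGap]
    rw [this]
    cases a <;> simp [Spaced, leadGap]
    tauto

theorem spaced_left {l m : List Bool} (h : Spaced (l ++ m)) : Spaced l := (spaced_append.1 h).1
theorem spaced_right {l m : List Bool} (h : Spaced (l ++ m)) : Spaced m := (spaced_append.1 h).2.1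

end BoolWords

/-! ### Words up to commutation, and full commutativity through projections -/

noncomputable section Words

variable {V : Type*} (G : SimpleGraph V)

open Classical in
/-- The projection of a word to a vertex `s` and its neighbours: `s` becomes `true`, its neighbours
become `false`, the other letters are dropped. -/
def proj (s : V) (ω : List V) : List Bool :=
  ω.filterMap fun t => if t = s then some true else if G.Adj s t then some false else none

variable {G}

@[simp] theorem proj_nil (s : V) : proj G s [] = [] := rfl

@[simp] theorem proj_append (s : V) (x y : List V) :
    proj G s (x ++ y) = proj G s x ++ proj G s y := by simp [proj]

@[simp] theorem proj_reverse (s : V) (x : List V) :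
    proj G s x.reverse = (proj G s x).reverse := by simp [proj]

@[simp] theorem proj_cons_self (s : V) (x : List V) : proj G s (s :: x) = true :: proj G s x := by
  simp [proj]

theorem proj_cons_adj {s t : V} (h : G.Adj s t) (x : List V) :
    proj G s (t :: x) = false :: proj G s x := by
  simp [proj, h, h.ne.symm]

theorem proj_cons_other {s t : V} (h : ¬ G.Adj s t) (hne : t ≠ s) (x : List V) :
    proj G s (t :: x) = proj G s x := by
  simp [proj, h, hne]

theorem true_mem_proj {s : V} {ω : List V} : true ∈ proj G s ω ↔ s ∈ ω := by
  simp only [proj, List.mem_filterMap]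
  constructor
  · rintro ⟨t, ht, h⟩
    split_ifs at h with h1 <;> simp_all
  · intro h; exact ⟨s, h, by simp⟩

theorem false_mem_proj {s : V} {ω : List V} : false ∈ proj G s ω ↔ ∃ t ∈ ω, G.Adj s t := by
  simp only [proj, List.mem_filterMap]
  constructor
  · rintro ⟨t, ht, h⟩
    split_ifs at h with h1 h2 <;> simp_all
    exact ⟨t, ht, h2⟩
  · rintro ⟨t, ht, h⟩; exact ⟨t, ht, by simp [h, h.ne.symm]⟩

theorem proj_eq_nil {s : V} {ω : List V} (h1 : s ∉ ω) (h2 : ∀ t ∈ ω, ¬ G.Adj s t) :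
    proj G s ω = [] := by
  rw [List.eq_nil_iff_forall_not_mem]
  rintro (_ | _) h
  · obtain ⟨t, ht, h⟩ := false_mem_proj.1 h; exact h2 t ht h
  · exact h1 (true_mem_proj.1 h)

variable (G)

/-- Equivalence of words under exchanging neighbouring letters which are not adjacent in `G`. -/
inductive CommEq : List V → List V → Prop
  | refl (x : List V) : CommEq x x
  | swap (x : List V) {a b : V} (h : ¬ G.Adj a b) (y : List V) :
      CommEq (x ++ a :: b :: y) (x ++ b :: a :: y)
  | trans {x y z : List V} : CommEq x y → CommEq y z → CommEq x z

/-- Fully commutative words. -/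
def FCWord (ω : List V) : Prop := ∀ s, Spaced (proj G s ω)

/-- The letters are distinct and pairwise not adjacent. -/
def Antichain (ω : List V) : Prop := ω.Pairwise fun a b => a ≠ b ∧ ¬ G.Adj a b

variable {G}

namespace CommEq

theorem symm {x y : List V} (h : CommEq G x y) : CommEq G y x := by
  induction h with
  | refl x => exact .refl x
  | swap x h y => exact .swap x (fun h' => h h'.symm) y
  | trans _ _ h1 h2 => exact h2.trans h1

theorem append_left {x y : List V} (h : CommEq G x y) (z : List V) :
    CommEq G (z ++ x) (z ++ y) := by
  induction h with
  | refl x => exact .refl _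
  | swap x h y => simpa using CommEq.swap (z ++ x) h y
  | trans _ _ h1 h2 => exact h1.trans h2

theorem append_right {x y : List V} (h : CommEq G x y) (z : List V) :
    CommEq G (x ++ z) (y ++ z) := by
  induction h with
  | refl x => exact .refl _
  | swap x h y => simpa using CommEq.swap x h (y ++ z)
  | trans _ _ h1 h2 => exact h1.trans h2

theorem cons {x y : List V} (h : CommEq G x y) (a : V) : CommEq G (a :: x) (a :: y) :=
  h.append_left [a]

theorem reverse {x y : List V} (h : CommEq G x y) : CommEq G x.reverse y.reverse := by
  induction h with
  | refl x => exact .refl _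
  | swap x h y => simpa using CommEq.swap y.reverse (fun h' => h h'.symm) x.reverse
  | trans _ _ h1 h2 => exact h1.trans h2

theorem perm {x y : List V} (h : CommEq G x y) : x.Perm y := by
  induction h with
  | refl x => exact .refl _
  | swap x h y => exact (List.Perm.swap _ _ y).append_left x
  | trans _ _ h1 h2 => exact h1.trans h2

theorem length_eq {x y : List V} (h : CommEq G x y) : x.length = y.length := h.perm.length_eq

theorem mem_iff {x y : List V} (h : CommEq G x y) {a : V} : a ∈ x ↔ a ∈ y := h.perm.mem_iff

/-- Two distinct non-adjacent letters both survive the projection to `s` only if both are neighbours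
of `s`, and then both become `false`. -/
theorem proj_eq {x y : List V} (h : CommEq G x y) (s : V) : proj G s x = proj G s y := by
  induction h with
  | refl x => rfl
  | trans _ _ h1 h2 => exact h1.trans h2
  | @swap x a b h y =>
    rw [proj_append, proj_append]
    congr 1
    by_cases hab : a = b
    · rw [hab]
    by_cases ha : a = s
    · subst ha
      rw [proj_cons_self, proj_cons_other h (Ne.symm hab), proj_cons_other h (Ne.symm hab),
        proj_cons_self]
    by_cases hb : b = s
    · subst hb
      have h' : ¬ G.Adj b a := fun h' => h h'.symm
      rw [proj_cons_self, proj_cons_other h' hab, proj_cons_other h' hab, proj_cons_self]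
    by_cases has : G.Adj s a <;> by_cases hbs : G.Adj s b
    · simp [proj_cons_adj, has, hbs]
    · simp [proj_cons_adj has, proj_cons_other hbs hb]
    · simp [proj_cons_adj hbs, proj_cons_other has ha]
    · simp [proj_cons_other has ha, proj_cons_other hbs hb]

theorem fcWord {x y : List V} (h : CommEq G x y) (hx : FCWord G x) : FCWord G y := fun s =>
  h.proj_eq s ▸ hx s

/-- A letter can be moved to the front across letters not adjacent to it. -/
theorem cons_middle {a : V} {x : List V} (h : ∀ b ∈ x, ¬ G.Adj a b) (y : List V) :
    CommEq G (x ++ a :: y) (a :: x ++ y) := by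
  induction x with
  | nil => exact .refl _
  | cons b x ih =>
    refine ((ih fun c hc => h c (by simp [hc])).cons b).trans ?_
    exact .swap [] (fun h' => h b (by simp) h'.symm) (x ++ y)

end CommEq

theorem commEq_of_perm {x y : List V} (hx : ∀ a ∈ x, ∀ b ∈ x, ¬ G.Adj a b) (h : x.Perm y) :
    CommEq G x y := by
  induction h with
  | nil => exact .refl _
  | cons a _ ih => exact (ih fun b hb c hc => hx b (by simp [hb]) c (by simp [hc])).cons a
  | swap a b l => exact .swap [] (hx b (by simp) a (by simp)) l
  | trans h1 _ ih1 ih2 =>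
    refine (ih1 hx).trans (ih2 fun a ha b hb => hx a (h1.mem_iff.2 ha) b (h1.mem_iff.2 hb))

/-- No neighbour of `s` precedes the first `s`, so that `s` can travel to the front. -/
theorem commEq_cons_of_leadGap {s : V} {ω : List V} (h : leadGap (proj G s ω) = 0) :
    ∃ z, CommEq G ω (s :: z) := by
  induction ω with
  | nil => simp [leadGap] at h
  | cons a ω ih =>
    by_cases ha : a = s
    · subst ha; exact ⟨ω, .refl _⟩
    by_cases has : G.Adj s a
    · simp [proj_cons_adj has, leadGap] at h
    rw [proj_cons_other has ha] at h
    obtain ⟨z, hz⟩ := ih h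
    exact ⟨a :: z, (hz.cons a).trans (.swap [] (fun h' => has h'.symm) z)⟩

theorem commEq_concat_of_trailGap {s : V} {ω : List V} (h : trailGap (proj G s ω) = 0) :
    ∃ z, CommEq G ω (z ++ [s]) := by
  obtain ⟨z, hz⟩ := commEq_cons_of_leadGap (s := s) (ω := ω.reverse) (by simpa [trailGap] using h)
  exact ⟨z.reverse, by simpa using hz.reverse⟩

theorem trailGap_proj (s : V) (ω : List V) :
    trailGap (proj G s ω) = leadGap (proj G s ω.reverse) := by simp [trailGap]

theorem leadGap_proj_reverse (s : V) (ω : List V) :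
    leadGap (proj G s ω.reverse) = trailGap (proj G s ω) := by simp [trailGap]

namespace FCWord

theorem left {x y : List V} (h : FCWord G (x ++ y)) : FCWord G x := fun s =>
  spaced_left (by simpa using h s)

theorem right {x y : List V} (h : FCWord G (x ++ y)) : FCWord G y := fun s =>
  spaced_right (l := proj G s x) (by simpa using h s)

theorem tail {a : V} {y : List V} (h : FCWord G (a :: y)) : FCWord G y := right (x := [a]) h

theorem reverse {x : List V} (h : FCWord G x) : FCWord G x.reverse := fun s => by
  rw [proj_reverse, spaced_reverse]; exact h s

theorem cons {s : V} {x : List V} (h : FCWord G x) (hs : 2 ≤ leadGap (proj G s x)) :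
    FCWord G (s :: x) := by
  intro t
  by_cases hst : s = t
  · subst hst; simpa [Spaced] using ⟨hs, h s⟩
  by_cases ha : G.Adj t s
  · rw [proj_cons_adj ha]; exact h t
  · rw [proj_cons_other ha hst]; exact h t

theorem two_le_of_cons {s : V} {x : List V} (h : FCWord G (s :: x)) :
    2 ≤ leadGap (proj G s x) := by
  have := h s
  rw [proj_cons_self] at this
  exact this.1

end FCWord

/-- `s t` can be split off on the left if `s` comes first and only `s` precedes the first `t`. -/
theorem commEq_cons_cons {s t : V} {ω : List V} (hst : G.Adj s t)
    (hs : leadGap (proj G s ω) = 0) (ht : leadGap (proj G t ω) = 1) :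
    ∃ z, CommEq G ω (s :: t :: z) := by
  obtain ⟨z, hz⟩ := commEq_cons_of_leadGap hs
  rw [hz.proj_eq, proj_cons_adj hst.symm, leadGap] at ht
  obtain ⟨z', hz'⟩ := commEq_cons_of_leadGap (Nat.succ.inj ht)
  exact ⟨z', hz.trans (hz'.cons s)⟩

theorem commEq_concat_concat {s t : V} {ω : List V} (hst : G.Adj s t)
    (hs : trailGap (proj G s ω) = 0) (ht : trailGap (proj G t ω) = 1) :
    ∃ z, CommEq G ω (z ++ [t, s]) := by
  obtain ⟨z, hz⟩ := commEq_cons_cons (ω := ω.reverse) hst (by simpa [trailGap] using hs)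
    (by simpa [trailGap] using ht)
  exact ⟨z.reverse, by simpa using hz.reverse⟩

theorem Antichain.perm {x y : List V} (h : Antichain G x) (hxy : x.Perm y) : Antichain G y :=
  (hxy.pairwise_iff fun {_ _} h => ⟨h.1.symm, fun h' => h.2 h'.symm⟩).1 h

theorem Antichain.not_adj {x : List V} (h : Antichain G x) {a b : V} (ha : a ∈ x) (hb : b ∈ x) :
    ¬ G.Adj a b := by
  intro hab
  induction x with
  | nil => simp at ha
  | cons c x ih =>
    rw [Antichain, List.pairwise_cons] at h
    rcases List.mem_cons.1 ha with ha | ha <;> rcases List.mem_cons.1 hb with hb | hb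
    · exact hab.ne (ha.trans hb.symm)
    · exact (h.1 _ hb).2 (ha ▸ hab)
    · exact (h.1 _ ha).2 (hb ▸ hab.symm)
    · exact ih h.2 ha hb

theorem Antichain.nodup {x : List V} (h : Antichain G x) : x.Nodup := h.imp fun h => h.1

theorem antichain_of {x : List V} (h : x.Nodup) (h' : ∀ a ∈ x, ∀ b ∈ x, ¬ G.Adj a b) :
    Antichain G x :=
  (h.and (List.pairwise_of_forall_mem_list h')).imp fun h => h

/-- The projection of an antichain to one of its members. -/
theorem Antichain.proj_mem {x : List V} (h : Antichain G x) {s : V} (hs : s ∈ x) :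
    proj G s x = [true] := by
  obtain ⟨y, z, rfl⟩ := List.append_of_mem hs
  have hn := h.nodup
  rw [List.nodup_append] at hn
  have h1 : proj G s y = [] := proj_eq_nil (fun hy => hn.2.2 s hy s (by simp) rfl)
    fun t ht => h.not_adj hs (by simp [ht])
  have h2 : proj G s z = [] := proj_eq_nil (List.nodup_cons.1 hn.2.1).1
    fun t ht => h.not_adj hs (by simp [ht])
  simp [h1, h2]

end Words

/-! ### There is no periodic fully commutative sequence in type `E` -/

section Periodic

/-- Adjacency in the infinite graph `E_∞`. -/
def EAdj (a b : ℕ) : Prop :=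
  (1 ≤ a ∧ b = a + 1) ∨ (1 ≤ b ∧ a = b + 1) ∨ (a = 0 ∧ b = 3) ∨ (a = 3 ∧ b = 0)

/-- `i < j` are successive positions of the same value of `g`. -/
def Successive (g : ℕ → ℕ) (i j : ℕ) : Prop :=
  i < j ∧ g i = g j ∧ ∀ k, i < k → k < j → g k ≠ g i

theorem exists_successive_right {g : ℕ → ℕ} {i j : ℕ} (hij : i < j) (h : g i = g j) :
    ∃ j' ≤ j, Successive g i j' := by
  classical
  have hex : ∃ k, i < k ∧ g i = g k := ⟨j, hij, h⟩
  refine ⟨Nat.find hex, Nat.find_min' hex ⟨hij, h⟩, (Nat.find_spec hex).1,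
    (Nat.find_spec hex).2, fun k hk hk' he => ?_⟩
  exact Nat.find_min hex hk' ⟨hk, he.symm⟩

theorem exists_successive_left {g : ℕ → ℕ} {i j : ℕ} (hij : i < j) (h : g i = g j) :
    ∃ i' ≥ i, Successive g i' j := by
  induction hm : j - i using Nat.strong_induction_on generalizing i with
  | _ m ih =>
    by_cases hk : ∃ k, i < k ∧ k < j ∧ g k = g i
    · obtain ⟨k, h1, h2, h3⟩ := hk
      obtain ⟨i', h4, h5⟩ := ih (j - k) (by omega) h2 (h3.trans h) rfl
      exact ⟨i', by omega, h5⟩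
    · push Not at hk
      exact ⟨i, le_rfl, hij, h, hk⟩

variable {n L : ℕ} {g : ℕ → ℕ}

/-- Induction from the far end of the long arm: if both neighbours found between successive `x` were
`x + 1`, the previous stage would put another `x` between them. -/
theorem exists_pred_between (hlt : ∀ i, g i < n)
    (hgood : ∀ i j, Successive g i j →
      ∃ k l, i < k ∧ k < l ∧ l < j ∧ EAdj (g i) (g k) ∧ EAdj (g i) (g l))
    (d x : ℕ) (hx : x + d = n) (h4 : 4 ≤ x) {i j : ℕ} (hij : i < j) (hi : g i = x) (hj : g j = x) :
    ∃ k, i < k ∧ k < j ∧ g k = x - 1 := by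
  induction d generalizing x i j with
  | zero => have := hlt i; omega
  | succ d ih =>
    obtain ⟨j', hj', hs⟩ := exists_successive_right hij (hi.trans hj.symm)
    obtain ⟨k, l, h1, h2, h3, h5, h6⟩ := hgood i j' hs
    rw [hi] at h5 h6
    by_cases hk : g k = x - 1
    · exact ⟨k, h1, by omega, hk⟩
    by_cases hl : g l = x - 1
    · exact ⟨l, by omega, by omega, hl⟩
    have hk' : g k = x + 1 := by unfold EAdj at h5; omega
    have hl' : g l = x + 1 := by unfold EAdj at h6; omega
    obtain ⟨m, h7, h8, h9⟩ := ih (x + 1) (by omega) (by omega) h2 hk' hl'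
    exact absurd (h9.trans (by omega)) (hs.2.2 m (by omega) (by omega))

/-- The two short arms force a `4` between any two successive `3`s. Induction along the long arm
then forces every `m ≥ 3` to occur, with an `m + 1` between successive occurrences, against the
bound `n`. -/
theorem not_periodic (hn : 5 ≤ n) (hL : 0 < L) (hper : ∀ i, g (i + L) = g i)
    (hlt : ∀ i, g i < n)
    (hgood : ∀ i j, Successive g i j →
      ∃ k l, i < k ∧ k < l ∧ l < j ∧ EAdj (g i) (g k) ∧ EAdj (g i) (g l)) : False := by
  have next : ∀ i, ∃ j, Successive g i j := fun i => by
    obtain ⟨j, -, h⟩ := exists_successive_right (g := g) (i := i) (j := i + L) (by omega)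
      (hper i).symm
    exact ⟨j, h⟩
  have pred := fun d x hx h4 => @exists_pred_between n g hlt hgood d x hx h4
  have p1 : ∀ i j, i < j → g i = 1 → g j = 1 → ∃ k, i < k ∧ k < j ∧ g k = 2 := by
    intro i j hij hi hj
    obtain ⟨j', hj', hs⟩ := exists_successive_right hij (hi.trans hj.symm)
    obtain ⟨k, l, h1, h2, h3, h5, h6⟩ := hgood i j' hs
    exact ⟨k, h1, by omega, by unfold EAdj at h5; omega⟩
  have p2 : ∀ i j, i < j → g i = 2 → g j = 2 → ∃ k, i < k ∧ k < j ∧ g k = 3 := by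
    intro i j hij hi hj
    obtain ⟨j', hj', hs⟩ := exists_successive_right hij (hi.trans hj.symm)
    obtain ⟨k, l, h1, h2, h3, h5, h6⟩ := hgood i j' hs
    rw [hi] at h5 h6
    by_cases hk : g k = 3
    · exact ⟨k, h1, by omega, hk⟩
    by_cases hl : g l = 3
    · exact ⟨l, by omega, by omega, hl⟩
    obtain ⟨m, h7, h8, h9⟩ := p1 k l h2 (by unfold EAdj at h5; omega) (by unfold EAdj at h6; omega)
    exact absurd (h9.trans hi.symm) (hs.2.2 m (by omega) (by omega))
  have p0 : ∀ i j, i < j → g i = 0 → g j = 0 →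
      ∃ k l, i < k ∧ k < l ∧ l < j ∧ g k = 3 ∧ g l = 3 := by
    intro i j hij hi hj
    obtain ⟨j', hj', hs⟩ := exists_successive_right hij (hi.trans hj.symm)
    obtain ⟨k, l, h1, h2, h3, h5, h6⟩ := hgood i j' hs
    exact ⟨k, l, h1, h2, by omega, by unfold EAdj at h5; omega, by unfold EAdj at h6; omega⟩
  have p4 : ∀ i j, i < j → g i = 4 → g j = 4 → ∃ k, i < k ∧ k < j ∧ g k = 3 :=
    fun i j => pred (n - 4) 4 (by omega) le_rfl
  have three : ∃ i, g i = 3 := by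
    have big : ∀ d i, g i = 3 + d → ∃ i, g i = 3 := by
      intro d
      induction d with
      | zero => exact fun i h => ⟨i, h⟩
      | succ d ih =>
        intro i h
        have := hlt i
        obtain ⟨k, -, -, hk⟩ := pred (n - (3 + (d + 1))) (3 + (d + 1)) (by omega) (by omega)
          (show i < i + L by omega) h (by rw [hper, h])
        exact ih k (by omega)
    have two : ∀ i, g i = 2 → ∃ i, g i = 3 := fun i h => by
      obtain ⟨k, -, -, hk⟩ := p2 i (i + L) (by omega) h (by rw [hper, h])
      exact ⟨k, hk⟩
    rcases Nat.lt_or_ge (g 0) 3 with h | h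
    · interval_cases h0 : g 0
      · obtain ⟨k, -, -, -, -, hk, -⟩ := p0 0 (0 + L) (by omega) h0 (by rw [hper, h0])
        exact ⟨k, hk⟩
      · obtain ⟨k, -, -, hk⟩ := p1 0 (0 + L) (by omega) h0 (by rw [hper, h0])
        exact two k hk
      · exact two 0 h0
    · exact big (g 0 - 3) 0 (by omega)
  -- two neighbours in a gap between successive threes are of two different kinds
  have gap : ∀ i j, Successive g i j → g i = 3 → ∀ x, x = 0 ∨ x = 2 ∨ x = 4 →
      (∀ k, i < k → k < j → g k ≠ x) → ∀ y, y = 0 ∨ y = 2 ∨ y = 4 → y ≠ x →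
      ∃ k, i < k ∧ k < j ∧ g k = y := by
    intro i j hs hi x hx hno y hy hyx
    by_contra! hcon
    obtain ⟨k, l, h1, h2, h3, h5, h6⟩ := hgood i j hs
    have hno3 := hs.2.2
    rw [hi] at h5 h6 hno3
    have hk1 := hno k h1 (by omega)
    have hk2 := hcon k h1 (by omega)
    have hl1 := hno l (by omega) h3
    have hl2 := hcon l (by omega) h3
    have hkl : g k = g l ∧ (g k = 0 ∨ g k = 2 ∨ g k = 4) := by unfold EAdj at h5 h6; omega
    rcases hkl with ⟨he, hk | hk | hk⟩
    · obtain ⟨m, m', h7, h8, h9, h10, -⟩ := p0 k l h2 hk (he ▸ hk)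
      exact hno3 m (by omega) (by omega) h10
    · obtain ⟨m, h7, h8, h9⟩ := p2 k l h2 hk (he ▸ hk)
      exact hno3 m (by omega) (by omega) h9
    · obtain ⟨m, h7, h8, h9⟩ := p4 k l h2 hk (he ▸ hk)
      exact hno3 m (by omega) (by omega) h9
  -- A gap between `3`s without `4` contains a `0` and a `2`. Two `0`s are separated by two `3`s, so
  -- the gaps on either side contain no `0` and therefore a `2` each. Successive ones among these
  -- three `2`s have a single `3` between them, hence also a `1`. But then two `1`s have only the
  -- middle `2` between them, while `2` is their only neighbour and has to occur twice.
  have four : ∀ i j, Successive g i j → g i = 3 → ∃ k, i < k ∧ k < j ∧ g k = 4 := by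
    intro i j hs hi
    by_contra! hno
    -- The shift by one period ensures that there is a gap to the left.
    have hs1 : Successive g (i + L) (j + L) := by
      refine ⟨by have := hs.1; omega, by rw [hper, hper]; exact hs.2.1, fun k h1 h2 => ?_⟩
      have := hs.2.2 (k - L) (by omega) (by omega)
      rwa [← hper (k - L), Nat.sub_add_cancel (by omega), ← hper i] at this
    have hno1 : ∀ k, i + L < k → k < j + L → g k ≠ 4 := fun k h1 h2 => by
      have := hno (k - L) (by omega) (by omega)
      rwa [← hper, Nat.sub_add_cancel (by omega)] at this
    have hi1 : g (i + L) = 3 := by rw [hper, hi]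
    obtain ⟨i0, -, hs0⟩ := exists_successive_left (g := g) (show i < i + L by omega) (hper i).symm
    obtain ⟨j2, hs2⟩ := next (j + L)
    generalize i + L = i1 at *
    generalize j + L = j1 at *
    have hi0 : g i0 = 3 := hs0.2.1.trans hi1
    have hj1 : g j1 = 3 := hs1.2.1.symm.trans hi1
    have l0 := hs0.1
    have l1 := hs1.1
    have l2 := hs2.1
    obtain ⟨p, hp1, hp2, hp⟩ := gap i1 j1 hs1 hi1 4 (by simp) hno1 0 (by simp) (by simp)
    obtain ⟨b, hb1, hb2, hb⟩ := gap i1 j1 hs1 hi1 4 (by simp) hno1 2 (by simp) (by simp)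
    have only3 : ∀ k, i0 < k → k < j2 → g k = 3 → k = i1 ∨ k = j1 := by
      intro k h1 h2 h3
      by_contra! hne
      rcases Nat.lt_trichotomy k i1 with h | h | h
      · exact hs0.2.2 k h1 h (h3.trans hi0.symm)
      · exact hne.1 h
      rcases Nat.lt_trichotomy k j1 with h' | h' | h'
      · exact hs1.2.2 k h h' (h3.trans hi1.symm)
      · exact hne.2 h'
      · exact hs2.2.2 k h' h2 (h3.trans hj1.symm)
    have no0 : ∀ k, j1 < k → k < j2 → g k ≠ 0 := by
      intro k h1 h2 h3
      obtain ⟨m, m', h4, h5, h6, h7, h8⟩ := p0 p k (by omega) hp h3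
      rcases only3 m (by omega) (by omega) h7 with h | h <;>
        rcases only3 m' (by omega) (by omega) h8 with h' | h' <;> omega
    have no0' : ∀ k, i0 < k → k < i1 → g k ≠ 0 := by
      intro k h1 h2 h3
      obtain ⟨m, m', h4, h5, h6, h7, h8⟩ := p0 k p (by omega) h3 hp
      rcases only3 m (by omega) (by omega) h7 with h | h <;>
        rcases only3 m' (by omega) (by omega) h8 with h' | h' <;> omega
    obtain ⟨c, hc1, hc2, hc⟩ := gap j1 j2 hs2 hj1 0 (by simp) no0 2 (by simp) (by simp)
    obtain ⟨a, ha1, ha2, ha⟩ := gap i0 i1 hs0 hi0 0 (by simp) no0' 2 (by simp) (by simp)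
    -- `a`, `b`, `c` are the only occurrences of `2` from `a` to `c`
    have only2 : ∀ k, a < k → k < c → g k = 2 → k = b := by
      intro k h1 h2 h3
      by_contra hne
      rcases Nat.lt_trichotomy k i1 with h | h | h
      · obtain ⟨m, h4, h5, h6⟩ := p2 a k h1 ha h3
        rcases only3 m (by omega) (by omega) h6 <;> omega
      · subst h; omega
      rcases Nat.lt_trichotomy k j1 with h' | h' | h'
      · rcases Nat.lt_or_gt_of_ne hne with h'' | h''
        · obtain ⟨m, h4, h5, h6⟩ := p2 k b h'' h3 hb
          rcases only3 m (by omega) (by omega) h6 <;> omega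
        · obtain ⟨m, h4, h5, h6⟩ := p2 b k h'' hb h3
          rcases only3 m (by omega) (by omega) h6 <;> omega
      · subst h'; omega
      · obtain ⟨m, h4, h5, h6⟩ := p2 k c h2 h3 hc
        rcases only3 m (by omega) (by omega) h6 <;> omega
    have one : ∀ k l, Successive g k l → g k = 2 →
        (∃ t, ∀ m, k < m → m < l → g m = 3 → m = t) → ∃ d, k < d ∧ d < l ∧ g d = 1 := by
      rintro k l hs hk ⟨t, ht⟩
      obtain ⟨m, m', h1, h2, h3, h5, h6⟩ := hgood k l hs
      rw [hk] at h5 h6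
      by_cases hm : g m = 1
      · exact ⟨m, h1, by omega, hm⟩
      by_cases hm' : g m' = 1
      · exact ⟨m', by omega, by omega, hm'⟩
      have e1 := ht m h1 (by omega) (by unfold EAdj at h5; omega)
      have e2 := ht m' (by omega) (by omega) (by unfold EAdj at h6; omega)
      omega
    obtain ⟨d, hd1, hd2, hd⟩ := one a b
      ⟨by omega, ha.trans hb.symm, fun k h1 h2 h3 => by
        have := only2 k h1 (by omega) (h3.trans ha); omega⟩ ha
      ⟨i1, fun m h1 h2 h3 => by rcases only3 m (by omega) (by omega) h3 <;> omega⟩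
    obtain ⟨e, he1, he2, he⟩ := one b c
      ⟨by omega, hb.trans hc.symm, fun k h1 h2 h3 => by
        have := only2 k (by omega) h2 (h3.trans hb); omega⟩ hb
      ⟨j1, fun m h1 h2 h3 => by rcases only3 m (by omega) (by omega) h3 <;> omega⟩
    obtain ⟨e', he', hs3⟩ := exists_successive_right (show d < e by omega) (hd.trans he.symm)
    obtain ⟨m, m', h1, h2, h3, h5, h6⟩ := hgood d e' hs3
    rw [hd] at h5 h6
    have e1 := only2 m (by omega) (by omega) (by unfold EAdj at h5; omega)
    have e2 := only2 m' (by omega) (by omega) (by unfold EAdj at h6; omega)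
    omega
  -- Two neighbours `3 + d` between successive `3 + d + 1` would have, by the previous stage, a
  -- further `3 + d + 1` between them; so one of the neighbours is larger.
  have up : ∀ d, (∃ i, g i = 3 + d) ∧
      ∀ i j, Successive g i j → g i = 3 + d → ∃ k, i < k ∧ k < j ∧ g k = 3 + d + 1 := by
    intro d
    induction d with
    | zero => exact ⟨three, four⟩
    | succ d ih =>
      obtain ⟨⟨i, hi⟩, h⟩ := ih
      refine ⟨?_, fun i j hs hi => ?_⟩
      · obtain ⟨j, hj⟩ := next i
        obtain ⟨k, -, -, hk⟩ := h i j hj hi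
        exact ⟨k, hk⟩
      · obtain ⟨k, l, h1, h2, h3, h5, h6⟩ := hgood i j hs
        rw [hi] at h5 h6
        by_cases hk : g k = 3 + (d + 1) + 1
        · exact ⟨k, h1, by omega, hk⟩
        by_cases hl : g l = 3 + (d + 1) + 1
        · exact ⟨l, by omega, by omega, hl⟩
        have hk' : g k = 3 + d := by unfold EAdj at h5; omega
        have hl' : g l = 3 + d := by unfold EAdj at h6; omega
        obtain ⟨l', h7, h8⟩ := exists_successive_right h2 (hk'.trans hl'.symm)
        obtain ⟨m, h9, h10, h11⟩ := h k l' h8 hk'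
        exact absurd (h11.trans (by omega)) (hs.2.2 m (by omega) (by omega))
  obtain ⟨⟨i, hi⟩, -⟩ := up n
  have := hlt i
  omega

end Periodic

/-! ### From words to periodic sequences -/

section Positions

variable {V : Type*} {G : SimpleGraph V}

theorem exists_adj_of_proj_length {s : V} {m : List V} (hs : s ∉ m)
    (h : 1 ≤ (proj G s m).length) : ∃ (k : ℕ) (a : V), m[k]? = some a ∧ G.Adj s a := by
  obtain ⟨b, hb⟩ := List.exists_mem_of_length_pos (l := proj G s m) (by omega)
  cases b
  · obtain ⟨t, ht, hst⟩ := false_mem_proj.1 hb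
    obtain ⟨k, hk⟩ := List.mem_iff_getElem?.1 ht
    exact ⟨k, t, hk, hst⟩
  · exact absurd (true_mem_proj.1 hb) hs

theorem exists_adj_adj_of_proj_length {s : V} {m : List V} (hs : s ∉ m)
    (h : 2 ≤ (proj G s m).length) :
    ∃ (k l : ℕ) (a b : V), k < l ∧ m[k]? = some a ∧ m[l]? = some b ∧ G.Adj s a ∧ G.Adj s b := by
  induction m with
  | nil => simp at h
  | cons t m ih =>
    simp only [List.mem_cons, not_or] at hs
    by_cases hst : G.Adj s t
    · rw [proj_cons_adj hst] at h
      obtain ⟨k, a, h1, h2⟩ := exists_adj_of_proj_length hs.2 (by simpa using h)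
      exact ⟨0, k + 1, t, a, by omega, by simp, by simpa using h1, hst, h2⟩
    · rw [proj_cons_other hst (Ne.symm hs.1)] at h
      obtain ⟨k, l, a, b, h1, h2, h3, h4⟩ := ih hs.2 h
      exact ⟨k + 1, l + 1, a, b, by omega, by simpa using h2, by simpa using h3, h4⟩

/-- Full commutativity in terms of positions, the form required by `not_periodic`. -/
theorem FCWord.exists_between {ω : List V} (h : FCWord G ω) {i j : ℕ} {s : V} (hij : i < j)
    (hi : ω[i]? = some s) (hj : ω[j]? = some s) (hk : ∀ k, i < k → k < j → ω[k]? ≠ some s) :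
    ∃ k l a b, i < k ∧ k < l ∧ l < j ∧ ω[k]? = some a ∧ ω[l]? = some b ∧
      G.Adj s a ∧ G.Adj s b := by
  obtain ⟨hi', hi''⟩ := List.getElem?_eq_some_iff.1 hi
  obtain ⟨hj', hj''⟩ := List.getElem?_eq_some_iff.1 hj
  set m := (ω.drop (i + 1)).take (j - i - 1) with hm
  have hget : ∀ k a, m[k]? = some a → i + 1 + k < j ∧ ω[i + 1 + k]? = some a := by
    intro k a h
    rw [hm, List.getElem?_take] at h
    split_ifs at h with h1
    rw [List.getElem?_drop] at h
    exact ⟨by omega, h⟩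
  have e1 : ω.drop i = s :: (m ++ s :: ω.drop (j + 1)) := by
    rw [List.drop_eq_getElem_cons hi', hi'', hm]
    congr 1
    conv_lhs => rw [← List.take_append_drop (j - i - 1) (ω.drop (i + 1))]
    congr 1
    rw [List.drop_drop, show i + 1 + (j - i - 1) = j by omega, List.drop_eq_getElem_cons hj', hj'']
  have hsm : s ∉ m := by
    intro hs
    obtain ⟨k, hk'⟩ := List.mem_iff_getElem?.1 hs
    obtain ⟨h1, h2⟩ := hget k s hk'
    exact hk _ (by omega) h1 h2
  have h1 : FCWord G (s :: (m ++ s :: ω.drop (j + 1))) := by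
    rw [← List.take_append_drop i ω] at h
    rw [← e1]; exact h.right
  have h2 := h1.two_le_of_cons
  rw [proj_append, leadGap_append_of_notMem (fun h => hsm (true_mem_proj.1 h)),
    proj_cons_self, leadGap] at h2
  obtain ⟨k, l, a, b, hkl, hka, hlb, hab⟩ := exists_adj_adj_of_proj_length hsm h2
  obtain ⟨-, h4⟩ := hget k a hka
  obtain ⟨h5, h6⟩ := hget l b hlb
  exact ⟨i + 1 + k, i + 1 + l, a, b, by omega, by omega, h5, h4, h6, hab⟩

end Positions

/-- The Coxeter graph of type `E n`. -/
def eGraph (n : ℕ) : SimpleGraph (Fin n) where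
  Adj := TypeE.Adj n
  symm := ⟨fun _ _ h => h.symm⟩
  loopless := ⟨fun _ h => h.ne rfl⟩

/-- Repeat `r` periodically. Successive occurrences of a letter are at most one period apart; with
the first moved into the initial period, both lie inside `r ++ r`, which supplies the two neighbours
between them. -/
theorem eq_nil_of_fcWord_append_self {n : ℕ} (hn : 5 ≤ n) {r : List (Fin n)}
    (h : FCWord (eGraph n) (r ++ r)) : r = [] := by
  by_contra hr
  have hL : 0 < r.length := List.length_pos_of_ne_nil hr
  set L := r.length with hLdef
  have hmod : ∀ i, i % L < r.length := fun i => Nat.mod_lt _ hL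
  set f : ℕ → Fin n := fun i => r[i % L]'(hmod i) with hf
  have hget : ∀ k, k < 2 * L → (r ++ r)[k]? = some (f k) := by
    intro k hk
    rcases Nat.lt_or_ge k L with h1 | h1
    · rw [List.getElem?_append_left h1, List.getElem?_eq_getElem h1]
      simp only [hf, Nat.mod_eq_of_lt h1]
    · rw [List.getElem?_append_right h1, List.getElem?_eq_getElem (by omega)]
      simp only [hf]
      congr 2
      rw [Nat.mod_eq_sub_mod h1, Nat.mod_eq_of_lt (by omega)]
  have hper : ∀ i, f (i + L) = f i := fun i => by simp [hf]
  have hper' : ∀ q i, f (i + L * q) = f i := fun q i => by simp [hf]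
  refine not_periodic (g := fun i => (f i).val) hn hL (fun i => by rw [hper]) (fun i => (f i).2) ?_
  rintro i j ⟨h1, h2, h3⟩
  beta_reduce at h2 h3 ⊢
  have hjL : j ≤ i + L := by
    by_contra! hlt
    exact h3 (i + L) (by omega) hlt (by rw [hper])
  set q := i / L
  have hi : i = i % L + L * q := (Nat.mod_add_div i L).symm
  have hi0 : i % L < L := Nat.mod_lt _ hL
  set i0 := i % L
  obtain ⟨j0, rfl⟩ : ∃ j0, j = j0 + L * q := ⟨j - L * q, by omega⟩
  have e1 : f i = f i0 := by rw [hi, hper']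
  have e2 : f i0 = f j0 := by
    have := Fin.ext h2
    rwa [hper', e1] at this
  obtain ⟨k, l, a, b, h4, h5, h6, h7, h8, h9, h10⟩ := h.exists_between (i := i0) (j := j0)
    (s := f i0) (by omega) (hget _ (by omega)) (by rw [hget _ (by omega), e2]) (by
      intro k hk1 hk2 hk3
      rw [hget _ (by omega), Option.some_inj] at hk3
      refine h3 (k + L * q) (by omega) (by omega) ?_
      simp only [hper', e1, hk3])
  rw [hget _ (by omega), Option.some_inj] at h7 h8
  refine ⟨k + L * q, l + L * q, by omega, by omega, by omega, ?_, ?_⟩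
  · simp only [hper', e1, h7]; exact h9
  · simp only [hper', e1, h8]; exact h10

/-! ### Descents and star reducibility -/

section Structure

variable {V : Type*} {G : SimpleGraph V}

theorem not_adj_of_leadGap {a b : V} {ω : List V} (ha : leadGap (proj G a ω) = 0)
    (hb : leadGap (proj G b ω) = 0) : ¬ G.Adj a b := by
  intro hab
  obtain ⟨z, hz⟩ := commEq_cons_of_leadGap ha
  rw [hz.proj_eq, proj_cons_adj hab.symm, leadGap] at hb
  omega

theorem mem_of_leadGap {a : V} {ω : List V} (ha : leadGap (proj G a ω) < 2) : a ∈ ω := by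
  by_contra h
  rw [leadGap_of_notMem fun h' => h (true_mem_proj.1 h')] at ha
  omega

theorem exists_commEq_antichain_append {A ω : List V} (hA : A.Nodup)
    (h : ∀ a ∈ A, leadGap (proj G a ω) = 0) : ∃ z, CommEq G ω (A ++ z) := by
  induction A with
  | nil => exact ⟨ω, .refl _⟩
  | cons a A ih =>
    rw [List.nodup_cons] at hA
    obtain ⟨z, hz⟩ := ih hA.2 fun b hb => h b (by simp [hb])
    have h1 : proj G a A = [] := proj_eq_nil hA.1 fun t ht =>
      not_adj_of_leadGap (h a (by simp)) (h t (by simp [ht]))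
    have h2 := h a (by simp)
    rw [hz.proj_eq, proj_append, h1, List.nil_append] at h2
    obtain ⟨y, hy⟩ := commEq_cons_of_leadGap h2
    refine ⟨y, hz.trans ((hy.append_left A).trans ?_)⟩
    exact .cons_middle (fun b hb =>
      not_adj_of_leadGap (h a (by simp)) (h b (by simp [hb]))) y

theorem exists_commEq_append_antichain {A ω : List V} (hA : A.Nodup)
    (h : ∀ a ∈ A, trailGap (proj G a ω) = 0) : ∃ z, CommEq G ω (z ++ A) := by
  obtain ⟨z, hz⟩ := exists_commEq_antichain_append (G := G) (A := A.reverse) (ω := ω.reverse)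
    (by simpa using hA) (by simpa [trailGap] using h)
  exact ⟨z.reverse, by simpa using hz.reverse⟩

theorem antichain_of_proj {ω : List V} (h : ∀ s ∈ ω, proj G s ω = [true]) : Antichain G ω := by
  refine antichain_of (List.nodup_iff_sublist.2 fun a ha => ?_) fun a ha b hb hab => ?_
  · have h1 : (proj G a [a, a]).Sublist (proj G a ω) := ha.filterMap _
    rw [h a (ha.subset (by simp))] at h1
    simpa using h1.length_le
  · have := false_mem_proj.2 ⟨b, hb, hab⟩
    rw [h a ha] at this
    simp at this

/-- A letter with projection `[true]` occurs once and has no neighbour in the word, so its deletion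
is invisible in the projections to the other letters of the word. -/
theorem proj_filter_nonisolated {ω : List V}
    (P : V → Bool) (hP : ∀ s, P s = false ↔ proj G s ω = [true]) {x : V} (hx : x ∈ ω)
    (hPx : P x = true) : proj G x (ω.filter P) = proj G x ω := by
  simp only [proj, List.filterMap_filter]
  refine List.filterMap_congr fun s hs => ?_
  cases hPs : P s
  · have h1 := (hP s).1 hPs
    have h2 : ¬ G.Adj x s := fun h => by
      have := false_mem_proj.2 ⟨x, hx, h.symm⟩
      simp [h1] at this
    have h3 : s ≠ x := by rintro rfl; simp [hPs] at hPx
    simp [h2, h3]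
  · simp

/-- A fully commutative word with the same left and right descents is an antichain, unless it can
be shortened simultaneously on both sides. -/
theorem antichain_or_of_descents_eq (hF : ∀ r : List V, FCWord G (r ++ r) → r = []) {p : List V}
    (hp : FCWord G p)
    (hsym : ∀ s, leadGap (proj G s p) = 0 ↔ trailGap (proj G s p) = 0) :
    Antichain G p ∨ ∃ s x, G.Adj s x ∧ leadGap (proj G s p) = 0 ∧ trailGap (proj G s p) = 0 ∧
      leadGap (proj G x p) = 1 ∧ trailGap (proj G x p) = 1 := by
  classical
  by_contra! hcon
  obtain ⟨hanti, hno⟩ := hcon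
  -- Isolated letters commute with everything in `p` and are left out.
  set P : V → Bool := fun s => decide (proj G s p ≠ [true]) with hPdef
  set q := p.filter P with hq
  have hproj : ∀ x ∈ q, proj G x q = proj G x p := fun x hx => by
    rw [hq, List.mem_filter] at hx
    exact proj_filter_nonisolated P (by simp [hPdef]) hx.1 hx.2
  have hniso : ∀ x ∈ q, proj G x q ≠ [true] := fun x hx => by
    rw [hproj x hx]
    simpa [hPdef] using (List.mem_filter.1 hx).2
  have hqFC : FCWord G q := fun x => by
    by_cases hx : x ∈ q
    · rw [hproj x hx]; exact hp x
    · exact spaced_of_notMem fun h => hx (true_mem_proj.1 h)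
  have hqne : q ≠ [] := by
    intro h
    refine hanti (antichain_of_proj fun s hs => ?_)
    by_contra hne
    have : s ∈ q := List.mem_filter.2 ⟨hs, by simpa [hPdef] using hne⟩
    simp [h] at this
  -- `A` is the set of left descents of `q`, which are also its right descents. None of them is
  -- isolated, so each occurs a second time and `q` becomes `A y A`. If the second alternative
  -- fails, `(A y)(A y)` is fully commutative, hence empty, and so is `q`.
  set A := (q.filter fun s => decide (leadGap (proj G s q) = 0)).dedup with hA
  have hAmem : ∀ s, s ∈ A ↔ s ∈ q ∧ leadGap (proj G s q) = 0 := fun s => by simp [hA]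
  obtain ⟨z, hz⟩ := exists_commEq_antichain_append (G := G) (List.nodup_dedup _)
    (fun a ha => ((hAmem a).1 ha).2)
  rw [← hA] at hz
  have hAanti : Antichain G A := antichain_of (List.nodup_dedup _) fun a ha b hb =>
    not_adj_of_leadGap ((hAmem a).1 ha).2 ((hAmem b).1 hb).2
  obtain ⟨y, hy⟩ := exists_commEq_append_antichain (G := G) (A := A) (ω := z)
    (List.nodup_dedup _) fun a ha => by
      have haq := ((hAmem a).1 ha).1
      have h1 : proj G a q = true :: proj G a z := by
        rw [hz.proj_eq, proj_append, hAanti.proj_mem ha]; rfl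
      have h2 : trailGap (proj G a q) = 0 := by
        rw [hproj a haq, ← hsym, ← hproj a haq]; exact ((hAmem a).1 ha).2
      have h3 : true ∈ proj G a z := by
        by_contra h3
        have h4 := trailGap_append_of_notMem h3 [true]
        rw [List.singleton_append, ← h1, h2] at h4
        have h5 : proj G a z = [] := by
          rw [← List.length_eq_zero_iff]; omega
        exact hniso a haq (by rw [h1, h5])
      rw [h1, ← List.singleton_append, trailGap_append_of_mem h3] at h2
      exact h2
  have hqA : CommEq G q (A ++ y ++ A) := by simpa using hz.trans (hy.append_left A)
  have hFC := hqA.fcWord hqFC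
  have hnil := hF (A ++ y) fun x => by
    rw [proj_append, spaced_append]
    refine ⟨hFC.left x, hFC.left x, ?_⟩
    by_cases hxq : x ∈ q
    swap
    · have : true ∉ proj G x (A ++ y) := fun h => hxq <| hqA.mem_iff.2 <|
        List.mem_append_left _ (true_mem_proj.1 h)
      rw [leadGap_of_notMem this]; omega
    by_cases hxA : x ∈ A
    · have h1 := hFC x
      rw [proj_append, spaced_append, hAanti.proj_mem hxA] at h1
      have := h1.2.2
      simp only [leadGap] at this
      omega
    have hxy : true ∈ proj G x (A ++ y) := by
      rw [hqA.mem_iff] at hxq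
      exact true_mem_proj.2 ((List.mem_append.1 hxq).resolve_right hxA)
    have hlead : leadGap (proj G x q) = leadGap (proj G x (A ++ y)) := by
      rw [hqA.proj_eq, proj_append, leadGap_append_of_mem hxy]
    have htrail : trailGap (proj G x q) = trailGap (proj G x (A ++ y)) + (proj G x A).length := by
      rw [hqA.proj_eq, proj_append, trailGap_append_of_notMem fun h => hxA (true_mem_proj.1 h)]
    have h1 : leadGap (proj G x q) ≠ 0 := fun h => hxA ((hAmem x).2 ⟨hxq, h⟩)
    have h2 : trailGap (proj G x q) ≠ 0 := fun h => h1 (by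
      rw [hproj x hxq] at h ⊢; exact (hsym x).2 h)
    have h3 : (proj G x A).length ≤ leadGap (proj G x q) := by
      rw [hqA.proj_eq, List.append_assoc, proj_append,
        leadGap_append_of_notMem fun h => hxA (true_mem_proj.1 h)]
      omega
    -- The inequalities leave a single possibility: `x` has gap `1` at both ends of `q`, and exactly
    -- one neighbour in `A`.
    by_contra hlt
    have h4 : leadGap (proj G x q) = 1 := by omega
    have h5 : trailGap (proj G x q) = 1 := by omega
    have h6 : (proj G x A).length = 1 := by omega
    have h7 : false ∈ proj G x A := by
      obtain ⟨b, hb⟩ := List.exists_mem_of_length_pos (l := proj G x A) (by omega)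
      cases b
      · exact hb
      · exact absurd (true_mem_proj.1 hb) hxA
    obtain ⟨s, hsA, hxs⟩ := false_mem_proj.1 h7
    have hs := (hAmem s).1 hsA
    rw [hproj s hs.1] at hs
    rw [hproj x hxq] at h4 h5
    exact hno s x hxs.symm hs.2 ((hsym s).1 hs.2) h4 h5
  exact hqne (List.length_eq_zero_iff.1 (by
    have := hqA.length_eq
    rw [List.append_eq_nil_iff] at hnil
    simpa [hnil.1, hnil.2] using this))

/-- `E_n` is star reducible. -/
theorem star_reducible (hF : ∀ r : List V, FCWord G (r ++ r) → r = []) {p : List V}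
    (hp : FCWord G p) : Antichain G p ∨ (∃ s t z, G.Adj s t ∧ CommEq G p (s :: t :: z)) ∨
      ∃ s t z, G.Adj s t ∧ CommEq G p (z ++ [t, s]) := by
  classical
  by_contra! hcon
  obtain ⟨hanti, hleft, hright⟩ := hcon
  set B := (p.filter fun s => decide (trailGap (proj G s p) = 0)).dedup with hB
  have hBmem : ∀ s, s ∈ B ↔ s ∈ p ∧ trailGap (proj G s p) = 0 := fun s => by simp [hB]
  obtain ⟨y, hy⟩ := exists_commEq_append_antichain (G := G) (List.nodup_dedup _)
    (fun a ha => ((hBmem a).1 ha).2)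
  rw [← hB] at hy
  have hBanti : Antichain G B := antichain_of (List.nodup_dedup _) fun a ha b hb => by
    have h1 := ((hBmem a).1 ha).2
    have h2 := ((hBmem b).1 hb).2
    rw [trailGap_proj] at h1 h2
    exact not_adj_of_leadGap h1 h2
  have hFC := hy.fcWord hp
  have hpal : CommEq G (y ++ B ++ y.reverse) (y ++ B ++ y.reverse).reverse := by
    have : CommEq G B B.reverse :=
      commEq_of_perm (fun a ha b hb => hBanti.not_adj ha hb) (List.reverse_perm B).symm
    simpa using (this.append_right y.reverse).append_left y
  -- Here `B` is the set of right descents of `p`, which is `y B` up to commutation. The palindrome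
  -- on `y B` can fail to be fully commutative only at a last letter `x` of `y` with a single
  -- neighbour in `B`, and this would be a right star reduction of `p`.
  have hmirror : FCWord G (y ++ B ++ y.reverse) := fun x => by
    rw [proj_append, spaced_append]
    refine ⟨hFC x, hFC.left.reverse x, ?_⟩
    rw [leadGap_proj_reverse, proj_append]
    by_cases hxB : x ∈ B
    · have h1 := hFC x
      rw [proj_append, hBanti.proj_mem hxB, spaced_append] at h1
      have := h1.2.2
      simp only [leadGap] at this
      omega
    rw [trailGap_append_of_notMem fun h => hxB (true_mem_proj.1 h)]
    by_contra hlt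
    have h0 : trailGap (proj G x y) = 0 := by omega
    have hxp : x ∈ p := by
      refine hy.mem_iff.2 (List.mem_append_left _ ?_)
      obtain ⟨z, hz⟩ := commEq_concat_of_trailGap h0
      exact hz.mem_iff.2 (by simp)
    have h1 : trailGap (proj G x p) = (proj G x B).length := by
      rw [hy.proj_eq, proj_append, trailGap_append_of_notMem fun h => hxB (true_mem_proj.1 h), h0,
        zero_add]
    have h2 : trailGap (proj G x p) ≠ 0 := fun h => hxB ((hBmem x).2 ⟨hxp, h⟩)
    have h3 : false ∈ proj G x B := by
      obtain ⟨b, hb⟩ := List.exists_mem_of_length_pos (l := proj G x B) (by omega)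
      cases b
      · exact hb
      · exact absurd (true_mem_proj.1 hb) hxB
    obtain ⟨s, hsB, hxs⟩ := false_mem_proj.1 h3
    obtain ⟨z, hz⟩ := commEq_concat_concat hxs.symm ((hBmem s).1 hsB).2 (by omega)
    exact hright s x z hxs.symm hz
  rcases antichain_or_of_descents_eq hF hmirror fun s => by
      rw [trailGap_proj, ← hpal.proj_eq] with h | ⟨s, x, hsx, h1, -, h2, -⟩
  · refine hanti (Antichain.perm (List.pairwise_append.1 h).1 hy.perm.symm)
  · have key : ∀ t, leadGap (proj G t (y ++ B ++ y.reverse)) < 2 →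
        leadGap (proj G t p) = leadGap (proj G t (y ++ B ++ y.reverse)) := by
      intro t ht
      have h3 : t ∈ y ++ B := by
        have := mem_of_leadGap ht
        simp only [List.mem_append, List.mem_reverse] at this ⊢
        tauto
      rw [proj_append _ (y ++ B), leadGap_append_of_mem (true_mem_proj.2 h3), hy.proj_eq]
    obtain ⟨z, hz⟩ := commEq_cons_cons hsx ((key s (by omega)).trans h1)
      ((key x (by omega)).trans h2)
    exact hleft s x z hsx hz

end Structure

/-! ### Norms and traces of fully commutative words at parameter `2` -/

noncomputable section Representation

variable {V : Type*} (G : SimpleGraph V) {X : Type*} [Fintype X]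

/-- The trace of a matrix, normalized to be `1` on the identity. -/
def ntr (M : Matrix X X ℝ) : ℝ := M.trace / Fintype.card X

theorem ntr_mul_comm (M N : Matrix X X ℝ) : ntr (M * N) = ntr (N * M) := by
  rw [ntr, ntr, Matrix.trace_mul_comm]

theorem ntr_smul (c : ℝ) (M : Matrix X X ℝ) : ntr (c • M) = c * ntr M := by
  rw [ntr, ntr, Matrix.trace_smul, smul_eq_mul, mul_div_assoc]

theorem ntr_sub (M N : Matrix X X ℝ) : ntr (M - N) = ntr M - ntr N := by
  rw [ntr, ntr, ntr, Matrix.trace_sub, sub_div]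

theorem ntr_transpose (M : Matrix X X ℝ) : ntr M.transpose = ntr M := by
  rw [ntr, ntr, Matrix.trace_transpose]

theorem ntr_transpose_mul_self_nonneg (M : Matrix X X ℝ) : 0 ≤ ntr (M.transpose * M) := by
  refine div_nonneg ?_ (Nat.cast_nonneg _)
  simp only [Matrix.trace, Matrix.diag_apply, Matrix.mul_apply, Matrix.transpose_apply]
  exact Finset.sum_nonneg fun i _ => Finset.sum_nonneg fun j _ => mul_self_nonneg _

theorem eq_zero_of_ntr_transpose_mul_self [Nonempty X] {M : Matrix X X ℝ}
    (h : ntr (M.transpose * M) = 0) : M = 0 := by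
  rw [ntr, div_eq_zero_iff, or_iff_left (by simp)] at h
  simp only [Matrix.trace, Matrix.diag_apply, Matrix.mul_apply, Matrix.transpose_apply] at h
  ext i j
  rw [Finset.sum_eq_zero_iff_of_nonneg
    fun i _ => Finset.sum_nonneg fun j _ => mul_self_nonneg _] at h
  have := h j (Finset.mem_univ _)
  rw [Finset.sum_eq_zero_iff_of_nonneg fun j _ => mul_self_nonneg _] at this
  exact mul_self_eq_zero.1 (this i (Finset.mem_univ _))

variable [DecidableEq X]

/-- The product of the matrices attached to the letters of a word. -/
def wordMat (B : V → Matrix X X ℝ) (ω : List V) : Matrix X X ℝ := (ω.map B).prod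

/-- Symmetric matrices satisfying the Temperley–Lieb relations of `G` with parameter `2`, such that
the normalized trace takes the expected values on antichains. -/
structure IsTLRep (B : V → Matrix X X ℝ) : Prop where
  symm : ∀ s, (B s).transpose = B s
  sq : ∀ s, B s * B s = (2 : ℝ) • B s
  comm : ∀ s t, ¬ G.Adj s t → B s * B t = B t * B s
  braid : ∀ s t, G.Adj s t → B s * B t * B s = B s
  ntr_antichain : ∀ A : List V, Antichain G A → 2 ^ A.length * ntr (wordMat B A) = 1

variable {G} {B : V → Matrix X X ℝ}

@[simp] theorem wordMat_nil : wordMat B [] = 1 := rfl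

@[simp] theorem wordMat_cons (s : V) (ω : List V) : wordMat B (s :: ω) = B s * wordMat B ω := by
  simp [wordMat]

@[simp] theorem wordMat_append (x y : List V) :
    wordMat B (x ++ y) = wordMat B x * wordMat B y := by simp [wordMat]

theorem wordMat_congr_of_comm (hB : ∀ s t, ¬ G.Adj s t → B s * B t = B t * B s) {x y : List V}
    (hxy : CommEq G x y) : wordMat B x = wordMat B y := by
  induction hxy with
  | refl x => rfl
  | swap x hab y => simp only [wordMat_append, wordMat_cons, ← mul_assoc (B _) (B _), hB _ _ hab]
  | trans _ _ h1 h2 => exact h1.trans h2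

namespace IsTLRep

variable (h : IsTLRep G B)
include h

theorem wordMat_reverse (x : List V) : wordMat B x.reverse = (wordMat B x).transpose := by
  induction x with
  | nil => simp
  | cons a x ih => simp [ih, Matrix.transpose_mul, h.symm]

theorem comm_mul {s t : V} (hst : ¬ G.Adj s t) (M : Matrix X X ℝ) :
    B s * (B t * M) = B t * (B s * M) := by
  rw [← mul_assoc, h.comm _ _ hst, mul_assoc]

theorem wordMat_congr {x y : List V} (hxy : CommEq G x y) : wordMat B x = wordMat B y :=
  wordMat_congr_of_comm h.comm hxy

theorem antichain_sq {A : List V} (hA : Antichain G A) :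
    wordMat B A * wordMat B A = (2 : ℝ) ^ A.length • wordMat B A := by
  induction A with
  | nil => simp
  | cons a A ih =>
    have hA' : Antichain G A := (List.pairwise_cons.1 hA).2
    have hc : wordMat B A * B a = B a * wordMat B A := by
      simpa using h.wordMat_congr (CommEq.cons_middle (x := A) (a := a)
        (fun b hb => hA.not_adj (by simp) (by simp [hb])) [])
    calc wordMat B (a :: A) * wordMat B (a :: A)
        = B a * (wordMat B A * B a) * wordMat B A := by simp only [wordMat_cons, mul_assoc]
      _ = (B a * B a) * (wordMat B A * wordMat B A) := by rw [hc]; simp only [mul_assoc]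
      _ = _ := by
        rw [h.sq, ih hA', smul_mul_assoc, mul_smul_comm, smul_smul, List.length_cons, pow_succ',
          wordMat_cons]

theorem sq_mul (s : V) (M : Matrix X X ℝ) : B s * (B s * M) = (2 : ℝ) • (B s * M) := by
  rw [← mul_assoc, h.sq, smul_mul_assoc]

theorem braid_mul {s t : V} (hst : G.Adj s t) (M : Matrix X X ℝ) :
    B s * (B t * (B s * M)) = B s * M := by
  rw [← mul_assoc, ← mul_assoc, h.braid _ _ hst]

/-- Fully commutative words have norm one. -/
theorem ntr_norm (hF : ∀ r : List V, FCWord G (r ++ r) → r = []) {p : List V} (hp : FCWord G p) :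
    ntr ((wordMat B p).transpose * wordMat B p) = 1 := by
  induction hm : p.length using Nat.strong_induction_on generalizing p with
  | _ m ih =>
    rcases star_reducible hF hp with hA | ⟨s, t, z, hst, hz⟩ | ⟨s, t, z, hst, hz⟩
    · rw [← h.wordMat_reverse, h.wordMat_congr
        (commEq_of_perm (fun a ha b hb => (hA.perm (List.reverse_perm p).symm).not_adj ha hb)
          (List.reverse_perm p)), h.antichain_sq hA, ntr_smul, h.ntr_antichain _ hA]
    -- `⟨stz, stz⟩ = 2 zᵀ t s t z = 2 zᵀ t z = ⟨tz, tz⟩` under the trace. The reduction on the right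
    -- is the mirror image, by cyclicity.
    · have h1 := ih (t :: z).length (by rw [← hm, hz.length_eq]; simp) (p := t :: z)
        (hz.fcWord hp).tail rfl
      rw [← h1, h.wordMat_congr hz]
      simp only [wordMat_cons, Matrix.transpose_mul, h.symm, mul_assoc]
      simp only [h.sq_mul, h.braid_mul hst.symm, mul_smul_comm]
    · have h1 := ih (z ++ [t]).length (by rw [← hm, hz.length_eq]; simp) (p := z ++ [t])
        (FCWord.left (y := [s]) (by simpa using hz.fcWord hp)) rfl
      rw [← h1, h.wordMat_congr hz]
      simp only [wordMat_append, wordMat_cons, wordMat_nil, mul_one, Matrix.transpose_mul, h.symm,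
        mul_assoc]
      rw [ntr_mul_comm (B s), ntr_mul_comm (B t)]
      simp only [mul_assoc, h.sq, mul_smul_comm]
      have e := h.braid t s hst.symm
      rw [mul_assoc] at e
      rw [ntr_smul, ntr_smul, ntr_mul_comm (B t)]
      simp only [mul_assoc, e]

/-- `⟨q, b_s q⟩ ≤ 1` unless `s` is a left descent of the fully commutative word `q`. -/
theorem ntr_le_one_of_not_descent (hF : ∀ r : List V, FCWord G (r ++ r) → r = []) {q : List V}
    (hq : FCWord G q) {s : V} (hs : leadGap (proj G s q) ≠ 0) :
    ntr ((wordMat B q).transpose * (B s * wordMat B q)) ≤ 1 := by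
  induction hm : q.length using Nat.strong_induction_on generalizing q s with
  | _ m ih =>
    -- In this case `s q` is fully commutative, so `2 ⟨q, s q⟩` is its norm `1`.
    by_cases h2 : 2 ≤ leadGap (proj G s q)
    · have h1 := h.ntr_norm hF (hq.cons h2)
      simp only [wordMat_cons, Matrix.transpose_mul, h.symm, mul_assoc, h.sq_mul, mul_smul_comm,
        ntr_smul] at h1
      linarith
    have hs1 : leadGap (proj G s q) = 1 := by omega
    rcases star_reducible hF hq with hA | ⟨c, d, z, hcd, hz⟩ | ⟨a, t, z, hat, hz⟩
    · exact absurd (by rw [hA.proj_mem (mem_of_leadGap (show leadGap (proj G s q) < 2 by omega))]; rfl) hs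
    · have hFC := hz.fcWord hq
      have hlen : q.length = z.length + 2 := hz.length_eq
      rw [hz.proj_eq] at hs1
      rw [h.wordMat_congr hz]
      have hcs : c ≠ s := by rintro rfl; simp [leadGap] at hs1
      -- Here `c s c = c` and `d c d = d` turn `⟨q, s q⟩` into the trace of `zᵀ d z`, which is half
      -- of the norm of `d z`.
      by_cases hsc : G.Adj s c
      · have h1 := h.ntr_norm hF hFC.tail
        simp only [wordMat_cons, Matrix.transpose_mul, h.symm, mul_assoc, h.sq_mul, mul_smul_comm,
          ntr_smul] at h1
        simp only [wordMat_cons, Matrix.transpose_mul, h.symm, mul_assoc, h.braid_mul hsc.symm,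
          h.braid_mul hcd.symm]
        linarith
      rw [proj_cons_other hsc hcs] at hs1
      -- Now `q` is `c d s y`, and `⟨q, s q⟩ = ⟨s y, c s y⟩`: the induction continues with the
      -- shorter word `s y` and its non-descent `c`.
      by_cases hsd : G.Adj s d
      · rw [proj_cons_adj hsd, leadGap, Nat.add_eq_right] at hs1
        obtain ⟨y, hy⟩ := commEq_cons_of_leadGap hs1
        have hFC' := ((hy.cons d).cons c).fcWord hFC
        have hgap : leadGap (proj G c (s :: y)) ≠ 0 := by
          have := hFC'.two_le_of_cons
          rw [proj_cons_adj hcd, leadGap] at this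
          omega
        have h1 := ih (s :: y).length (by rw [← hm, hlen, ← hy.length_eq]; simp) (q := s :: y)
          hFC'.tail.tail hgap rfl
        rw [h.wordMat_congr ((hy.cons d).cons c)]
        refine le_of_eq_of_le ?_ h1
        simp only [wordMat_cons, Matrix.transpose_mul, h.symm, mul_assoc]
        simp only [h.comm_mul hsc, h.sq_mul, mul_smul_comm, h.braid_mul hsd]
        rw [← h.comm_mul hsc (wordMat B y), h.braid_mul hsd]
      · have hds : d ≠ s := by rintro rfl; exact hsc hcd.symm
        have h1 := ih (d :: z).length (by rw [← hm, hlen]; simp) (q := d :: z) hFC.tail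
          (s := s) (by omega) rfl
        refine le_of_eq_of_le ?_ h1
        simp only [wordMat_cons, Matrix.transpose_mul, h.symm, mul_assoc]
        simp only [h.comm_mul hsc, h.sq_mul, mul_smul_comm, h.comm_mul hsd, h.braid_mul hcd.symm]
    · have hlen : q.length = z.length + 2 := by simpa using hz.length_eq
      have h1 := ih (z ++ [t]).length (by rw [← hm, hlen]; simp) (q := z ++ [t])
        (FCWord.left (y := [a]) (by simpa using hz.fcWord hq)) (s := s) (by
          intro h0
          obtain ⟨l, hl⟩ := leadGap_eq_zero.1 h0
          apply hs
          rw [hz.proj_eq, show z ++ [t, a] = (z ++ [t]) ++ [a] by simp, proj_append, hl]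
          rfl) rfl
      refine le_of_eq_of_le ?_ h1
      rw [h.wordMat_congr hz]
      simp only [wordMat_append, wordMat_cons, wordMat_nil, mul_one, Matrix.transpose_mul, h.symm,
        mul_assoc]
      rw [ntr_mul_comm (B a), ntr_mul_comm (B t)]
      simp only [mul_assoc, h.sq, mul_smul_comm]
      have e := h.braid t a hat.symm
      rw [mul_assoc] at e
      rw [ntr_smul, ntr_smul, ntr_mul_comm (B t)]
      simp only [mul_assoc, e]

/-- Makes descents visible in the matrix: the equation gives `⟨q, s q⟩ = 2`, while a non-descent
allows at most `1`. -/
theorem mul_wordMat_eq_iff [Nonempty X] (hF : ∀ r : List V, FCWord G (r ++ r) → r = [])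
    {q : List V} (hq : FCWord G q) {s : V} :
    B s * wordMat B q = (2 : ℝ) • wordMat B q ↔ leadGap (proj G s q) = 0 := by
  constructor
  · intro he
    by_contra hs
    have h1 := h.ntr_le_one_of_not_descent hF hq hs
    rw [he, mul_smul_comm, ntr_smul, h.ntr_norm hF hq] at h1
    norm_num at h1
  · intro h0
    obtain ⟨z, hz⟩ := commEq_cons_of_leadGap h0
    rw [h.wordMat_congr hz, wordMat_cons, h.sq_mul]

/-- A fully commutative word whose matrix is symmetric is conjugate to an antichain by a word and
its reverse. -/
theorem exists_palindrome [Nonempty X] (hF : ∀ r : List V, FCWord G (r ++ r) → r = [])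
    {p : List V} (hp : FCWord G p) (hsym : (wordMat B p).transpose = wordMat B p) :
    ∃ x A, Antichain G A ∧ CommEq G p (x ++ A ++ x.reverse) ∧
      2 ^ A.length * ntr (wordMat B p) = 1 := by
  induction hm : p.length using Nat.strong_induction_on generalizing p with
  | _ m ih =>
    -- Right descents are the left descents of the reversed word, whose matrix is the transpose.
    have hdesc : ∀ s, leadGap (proj G s p) = 0 ↔ trailGap (proj G s p) = 0 := fun s => by
      rw [trailGap_proj, ← h.mul_wordMat_eq_iff hF hp, ← h.mul_wordMat_eq_iff hF hp.reverse,
        h.wordMat_reverse, hsym]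
    rcases antichain_or_of_descents_eq hF hp hdesc with hA | ⟨s, x, hsx, h1, h2, h3, h4⟩
    · exact ⟨[], p, hA, by simpa using CommEq.refl p, h.ntr_antichain _ hA⟩
    obtain ⟨z, hz⟩ := commEq_cons_of_leadGap h1
    have hxz : x ∈ z := by
      have : x ∈ p := mem_of_leadGap (show leadGap (proj G x p) < 2 by omega)
      rw [hz.mem_iff, List.mem_cons] at this
      exact this.resolve_left hsx.ne.symm
    have htz : trailGap (proj G s z) = 0 := by
      rw [hz.proj_eq, proj_cons_self] at h2
      by_cases hsz : true ∈ proj G s z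
      · rwa [← List.singleton_append, trailGap_append_of_mem hsz] at h2
      · rw [← List.singleton_append, trailGap_append_of_notMem hsz] at h2
        have := List.length_pos_of_mem (false_mem_proj.2 ⟨x, hxz, hsx⟩)
        omega
    obtain ⟨y, hy⟩ := commEq_concat_of_trailGap htz
    have hpy : CommEq G p (s :: (y ++ [s])) := hz.trans (hy.cons s)
    have hyFC : FCWord G y := (hpy.fcWord hp).tail.left
    have hxs : proj G x [s] = [false] := by rw [proj_cons_adj hsx.symm]; rfl
    rw [hpy.proj_eq, proj_cons_adj hsx.symm, proj_append, hxs] at h3 h4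
    have hxy : true ∈ proj G x y := by
      by_contra hxy
      rw [leadGap, leadGap_append_of_notMem hxy] at h3
      simp [leadGap] at h3
    have h5 : leadGap (proj G x y) = 0 := by
      rw [leadGap, leadGap_append_of_mem hxy] at h3
      omega
    have h6 : trailGap (proj G x y) = 0 := by
      have e : false :: (proj G x y ++ [false]) = ([false] ++ proj G x y) ++ [false] := by simp
      rw [e, trailGap_append_of_notMem (by simp), trailGap_append_of_mem hxy] at h4
      simpa using h4
    have hxY := (h.mul_wordMat_eq_iff hF hyFC).2 h5
    have hYx : wordMat B y * B x = (2 : ℝ) • wordMat B y := by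
      rw [trailGap_proj] at h6
      have := congrArg Matrix.transpose ((h.mul_wordMat_eq_iff hF hyFC.reverse).2 h6)
      simpa [h.wordMat_reverse, Matrix.transpose_mul, h.symm] using this
    have hP : wordMat B p = B s * wordMat B y * B s := by
      rw [h.wordMat_congr hpy]; simp [mul_assoc]
    have hbr := h.braid x s hsx.symm
    -- The word is `s y s`, and `x` is a descent of `y` on both sides, so `x y x = 4 y`. Thus `4 x s
    -- y s x = (x s x) y (x s x) = x y x = 4 y`. The symmetry of `p` therefore passes to `y`.
    have hY : wordMat B y = B x * wordMat B p * B x := by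
      have e : (4 : ℝ) • (B x * wordMat B p * B x) = (4 : ℝ) • wordMat B y := by
        calc (4 : ℝ) • (B x * wordMat B p * B x)
            = B x * B s * ((2 : ℝ) • (2 : ℝ) • wordMat B y) * B s * B x := by
              rw [hP, smul_smul]; norm_num [mul_assoc]
          _ = B x * B s * (B x * wordMat B y * B x) * B s * B x := by
              rw [hxY, smul_mul_assoc, hYx]
          _ = (B x * B s * B x) * wordMat B y * (B x * B s * B x) := by simp only [mul_assoc]
          _ = (4 : ℝ) • wordMat B y := by
              rw [hbr, hxY, smul_mul_assoc, hYx, smul_smul]; norm_num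
      exact (smul_right_injective _ (by norm_num : (4 : ℝ) ≠ 0) e).symm
    have hYsym : (wordMat B y).transpose = wordMat B y := by
      conv_lhs => rw [hY]
      rw [Matrix.transpose_mul, Matrix.transpose_mul, hsym, h.symm, ← mul_assoc, ← hY]
    have htr : ntr (wordMat B p) = ntr (wordMat B y) := by
      have e : 4 * ntr (wordMat B p) = 4 * ntr (wordMat B y) := by
        calc 4 * ntr (wordMat B p) = ntr (B s * ((2 : ℝ) • (2 : ℝ) • wordMat B y) * B s) := by
              rw [hP, ← ntr_smul, smul_smul]; norm_num
          _ = ntr (B s * (B x * (wordMat B y * B x) * B s)) := by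
              have e1 : B x * (wordMat B y * B x) = (2 : ℝ) • (2 : ℝ) • wordMat B y := by
                rw [hYx, mul_smul_comm, hxY]
              rw [e1, mul_assoc]
          _ = 2 * ntr (wordMat B y * (B x * B s * B x)) := by
              rw [ntr_mul_comm (B s)]
              simp only [mul_assoc, h.sq, mul_smul_comm, ntr_smul]
              rw [ntr_mul_comm (B x)]
              simp only [mul_assoc]
          _ = 4 * ntr (wordMat B y) := by rw [hbr, hYx, ntr_smul]; ring
      linarith
    obtain ⟨x0, A, hA, hx0, hn⟩ := ih y.length (by rw [← hm, hpy.length_eq]; simp) hyFC hYsym rfl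
    refine ⟨s :: x0, A, hA, hpy.trans ?_, htr ▸ hn⟩
    simpa using (hx0.append_right [s]).cons s

/-- Bound for the trace of a fully commutative word containing an antichain, by the
Cauchy–Schwarz inequality. -/
theorem ntr_antichain_le [Nonempty X] (hF : ∀ r : List V, FCWord G (r ++ r) → r = [])
    {x A y : List V} (hA : Antichain G A) (hFC : FCWord G (x ++ A ++ y)) :
    2 ^ A.length * ntr (wordMat B (x ++ A ++ y)) ≤ 1 ∧
      (2 ^ A.length * ntr (wordMat B (x ++ A ++ y)) = 1 →
        (wordMat B (x ++ A ++ y)).transpose = wordMat B (x ++ A ++ y)) := by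
  set P := (wordMat B (x ++ A)).transpose with hP
  set Q := wordMat B (A ++ y) with hQ
  have hAy : FCWord G (A ++ y) := FCWord.right (x := x) (by simpa using hFC)
  have h1 : ntr (P.transpose * P) = 1 := by
    rw [hP, ← h.wordMat_reverse]; exact h.ntr_norm hF hFC.left.reverse
  have h2 : ntr (Q.transpose * Q) = 1 := h.ntr_norm hF hAy
  have hprod : P.transpose * Q = (2 : ℝ) ^ A.length • wordMat B (x ++ A ++ y) := by
    simp only [hP, hQ, Matrix.transpose_transpose, wordMat_append]
    rw [mul_assoc, ← mul_assoc (wordMat B A), h.antichain_sq hA, smul_mul_assoc, mul_smul_comm,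
      mul_assoc]
  have h3 : ntr (P.transpose * Q) = 2 ^ A.length * ntr (wordMat B (x ++ A ++ y)) := by
    rw [hprod, ntr_smul]
  have h4 : ntr (Q.transpose * P) = ntr (P.transpose * Q) := by
    rw [← ntr_transpose (P.transpose * Q), Matrix.transpose_mul, Matrix.transpose_transpose]
  -- For unit vectors, Cauchy–Schwarz is `‖P - Q‖² ≥ 0`. Equality gives `P = Q`, and then `Pᵀ Q = Qᵀ
  -- Q` is symmetric.
  have h5 : ntr ((P - Q).transpose * (P - Q)) = 2 - 2 * ntr (P.transpose * Q) := by
    rw [Matrix.transpose_sub, sub_mul, mul_sub, mul_sub, ntr_sub, ntr_sub, ntr_sub, h1, h2, h4]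
    ring
  rw [← h3]
  refine ⟨by have := ntr_transpose_mul_self_nonneg (P - Q); linarith, fun he => ?_⟩
  have h6 : P = Q := sub_eq_zero.1 (eq_zero_of_ntr_transpose_mul_self (by rw [h5, he]; ring))
  have h7 : ((2 : ℝ) ^ A.length) ≠ 0 := by positivity
  refine smul_right_injective _ h7 ?_
  change _ • _ = _ • _
  rw [← Matrix.transpose_smul, ← hprod, h6, Matrix.transpose_mul, Matrix.transpose_transpose]

end IsTLRep

end Representation

/-! ### Site and bond operators of the four-state Potts model -/

noncomputable section Potts

variable {C : Type*}

/-- The bond operator of the four-state Potts model, forcing the states of two sites to agree. -/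
def bondOp (a b : C) : Module.End ℝ ((C → Fin 4) → ℝ) where
  toFun f x := if x a = x b then 2 * f x else 0
  map_add' f g := by ext x; simp; split_ifs <;> ring
  map_smul' r f := by ext x; by_cases h : x a = x b <;> simp [h, mul_left_comm]

/-- The projection to the configurations with state `k` at the site `c`. -/
def stateOp (c : C) (k : Fin 4) : Module.End ℝ ((C → Fin 4) → ℝ) where
  toFun f x := if x c = k then f x else 0
  map_add' f g := by ext x; simp; split_ifs <;> ring
  map_smul' r f := by ext x; simp

theorem bondOp_apply (a b : C) (f : (C → Fin 4) → ℝ) (x : C → Fin 4) :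
    bondOp a b f x = if x a = x b then 2 * f x else 0 := rfl

theorem stateOp_apply (c : C) (k : Fin 4) (f : (C → Fin 4) → ℝ) (x : C → Fin 4) :
    stateOp c k f x = if x c = k then f x else 0 := rfl

theorem bondOp_symm (a b : C) : bondOp a b = bondOp b a := by
  ext1 f; funext x
  simp only [bondOp_apply, eq_comm]

theorem bondOp_sq (a b : C) : bondOp a b * bondOp a b = (2 : ℝ) • bondOp a b := by
  ext1 f; funext x
  simp only [Module.End.mul_apply, LinearMap.smul_apply, Pi.smul_apply, bondOp_apply, smul_eq_mul]
  split_ifs <;> simp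

theorem bondOp_comm (a b c d : C) : bondOp a b * bondOp c d = bondOp c d * bondOp a b := by
  ext1 f; funext x
  simp only [Module.End.mul_apply, bondOp_apply]
  split_ifs <;> simp

theorem sum_stateOp (c : C) : ∑ k, stateOp c k = 1 := by
  ext1 f; funext x
  simp [stateOp_apply, LinearMap.sum_apply, Finset.sum_apply]

theorem stateOp_sq (c : C) (k : Fin 4) : stateOp c k * stateOp c k = stateOp c k := by
  ext1 f; funext x
  simp only [Module.End.mul_apply, stateOp_apply]
  split_ifs <;> simp

theorem stateOp_bondOp_comm (c : C) (k : Fin 4) (a b : C) :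
    stateOp c k * bondOp a b = bondOp a b * stateOp c k := by
  ext1 f; funext x
  simp only [Module.End.mul_apply, stateOp_apply, bondOp_apply]
  split_ifs <;> simp

variable [DecidableEq C]

/-- The site operator of the four-state Potts model, averaging over the state of the site `c`. -/
def siteOp (c : C) : Module.End ℝ ((C → Fin 4) → ℝ) where
  toFun f x := (1 / 2) * ∑ k, f (Function.update x c k)
  map_add' f g := by ext x; simp [Finset.sum_add_distrib, mul_add]
  map_smul' r f := by ext x; simp [← Finset.mul_sum]; ring

theorem siteOp_apply (c : C) (f : (C → Fin 4) → ℝ) (x : C → Fin 4) :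
    siteOp c f x = (1 / 2) * ∑ k, f (Function.update x c k) := rfl

theorem siteOp_sq (c : C) : siteOp c * siteOp c = (2 : ℝ) • siteOp c := by
  ext1 f; funext x
  simp only [Module.End.mul_apply, LinearMap.smul_apply, Pi.smul_apply, siteOp_apply,
    Function.update_idem, smul_eq_mul, Finset.sum_const, Finset.card_univ, Fintype.card_fin]
  ring

theorem siteOp_comm (c d : C) : siteOp c * siteOp d = siteOp d * siteOp c := by
  by_cases hcd : c = d
  · rw [hcd]
  ext1 f; funext x
  simp only [Module.End.mul_apply, siteOp_apply, ← Finset.mul_sum]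
  rw [Finset.sum_comm]
  simp only [Function.update_comm hcd]

theorem siteOp_bondOp_comm {a b c : C} (ha : a ≠ c) (hb : b ≠ c) :
    siteOp c * bondOp a b = bondOp a b * siteOp c := by
  ext1 f; funext x
  simp only [Module.End.mul_apply, bondOp_apply, siteOp_apply, Function.update_of_ne ha,
    Function.update_of_ne hb]
  split_ifs
  · rw [← Finset.mul_sum]; ring
  · simp

theorem siteOp_bondOp_siteOp {a b : C} (hab : a ≠ b) :
    siteOp a * bondOp a b * siteOp a = siteOp a := by
  ext1 f; funext x
  simp only [Module.End.mul_apply, bondOp_apply, siteOp_apply, Function.update_self,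
    Function.update_of_ne hab.symm, Function.update_idem]
  simp

theorem bondOp_siteOp_bondOp {a b : C} (hab : a ≠ b) :
    bondOp a b * siteOp a * bondOp a b = bondOp a b := by
  ext1 f; funext x
  simp only [Module.End.mul_apply, bondOp_apply, siteOp_apply, Function.update_self,
    Function.update_of_ne hab.symm]
  split_ifs with h
  · simp [← h]
  · rfl

theorem stateOp_siteOp_stateOp (c : C) (k : Fin 4) :
    stateOp c k * siteOp c * stateOp c k = (1 / 2 : ℝ) • stateOp c k := by
  ext1 f; funext x
  simp only [Module.End.mul_apply, LinearMap.smul_apply, Pi.smul_apply, stateOp_apply,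
    siteOp_apply, Function.update_self, smul_eq_mul]
  split_ifs with h
  · simp [← h]
  · simp

theorem stateOp_siteOp_comm {c d : C} (hcd : c ≠ d) (k : Fin 4) :
    stateOp c k * siteOp d = siteOp d * stateOp c k := by
  ext1 f; funext x
  simp only [Module.End.mul_apply, stateOp_apply, siteOp_apply, Function.update_of_ne hcd]
  split_ifs <;> simp

variable [Fintype C]

/-- The matrix of an operator on the configuration space. -/
def pottsMat : Module.End ℝ ((C → Fin 4) → ℝ) ≃ₐ[ℝ] Matrix (C → Fin 4) (C → Fin 4) ℝ :=
  LinearMap.toMatrixAlgEquiv'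

theorem pottsMat_apply (f : Module.End ℝ ((C → Fin 4) → ℝ)) (x y : C → Fin 4) :
    pottsMat f x y = f (Pi.single y 1) x := by
  rw [pottsMat, LinearMap.toMatrixAlgEquiv'_apply]

theorem pottsMat_siteOp_transpose (c : C) :
    (pottsMat (siteOp c)).transpose = pottsMat (siteOp c) := by
  have key : ∀ x y : C → Fin 4, ∑ k, (Pi.single y (1 : ℝ) : (C → Fin 4) → ℝ)
      (Function.update x c k) = if ∀ i ≠ c, x i = y i then 1 else 0 := by
    intro x y
    simp only [Pi.single_apply, Function.update_eq_iff]
    by_cases h : ∀ i ≠ c, x i = y i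
    · simp only [and_iff_left h, if_pos h]
      simp
    · simp only [h, and_false, if_false, Finset.sum_const_zero]
  ext x y
  rw [Matrix.transpose_apply, pottsMat_apply, pottsMat_apply, siteOp_apply, siteOp_apply, key, key]
  simp only [eq_comm]

theorem pottsMat_bondOp_transpose (a b : C) :
    (pottsMat (bondOp a b)).transpose = pottsMat (bondOp a b) := by
  ext x y
  rw [Matrix.transpose_apply, pottsMat_apply, pottsMat_apply, bondOp_apply, bondOp_apply]
  by_cases h : x = y
  · rw [h]
  · simp [h, Ne.symm h]

/-- Splitting off a site operator from the trace. -/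
theorem ntr_siteOp_mul {c : C} {M : Module.End ℝ ((C → Fin 4) → ℝ)}
    (hM : ∀ k, stateOp c k * M = M * stateOp c k) :
    2 * ntr (pottsMat (siteOp c * M)) = ntr (pottsMat M) := by
  have hsum : ∀ N : Module.End ℝ ((C → Fin 4) → ℝ),
      ntr (pottsMat N) = ∑ k, ntr (pottsMat (stateOp c k * N)) := by
    intro N
    conv_lhs => rw [← one_mul N, ← sum_stateOp c, Finset.sum_mul, map_sum]
    simp only [ntr, Matrix.trace_sum, Finset.sum_div]
  -- The trace is cut up by the state at `c`, which `M` preserves; compressed to a fixed state, the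
  -- site operator is the scalar `1/2`.
  rw [hsum M, hsum, Finset.mul_sum]
  refine Finset.sum_congr rfl fun k _ => ?_
  have h1 : stateOp c k * (siteOp c * M) = stateOp c k * (stateOp c k * (siteOp c * M)) := by
    rw [← mul_assoc (stateOp c k) (stateOp c k), stateOp_sq]
  rw [h1, map_mul, ntr_mul_comm, ← map_mul,
    show stateOp c k * (siteOp c * M) * stateOp c k
      = (stateOp c k * siteOp c * stateOp c k) * M by
        simp only [mul_assoc, hM],
    stateOp_siteOp_stateOp, smul_mul_assoc, map_smul, ntr_smul]
  ring

/-- Splitting off a bond operator from the trace. -/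
theorem ntr_bondOp_mul {c d : C} (hcd : c ≠ d) {M : Module.End ℝ ((C → Fin 4) → ℝ)}
    (hM : ∀ k, stateOp c k * M = M * stateOp c k) (hM' : siteOp c * M = M * siteOp c) :
    2 * ntr (pottsMat (bondOp c d * M)) = ntr (pottsMat M) := by
  -- `M` does not act at `c`. A site operator at `c` is inserted, the bond is removed by
  -- `siteOp_bondOp_siteOp`, and the site operator is split off again.
  have h1 := ntr_siteOp_mul (c := c) (M := bondOp c d * M) fun k => by
    rw [← mul_assoc, stateOp_bondOp_comm, mul_assoc, hM, mul_assoc]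
  have h2 := ntr_siteOp_mul hM
  have h3 : 2 * ntr (pottsMat (siteOp c * (bondOp c d * M))) = ntr (pottsMat (siteOp c * M)) := by
    rw [← ntr_smul, ← map_smul, ← smul_mul_assoc, ← siteOp_sq, mul_assoc, map_mul, ntr_mul_comm,
      ← map_mul]
    congr 2
    rw [mul_assoc, mul_assoc, ← hM', ← mul_assoc, ← mul_assoc, siteOp_bondOp_siteOp hcd]
  linarith

end Potts

/-! ### The Potts representation of type `E` -/

noncomputable section EPotts

/-- The operator attached to the vertex `s` of the graph `E n`: odd vertices are sites of the Potts
model, the even vertices are bonds between the neighbouring sites; there is a ghost site `0`, and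
possibly one at the end. -/
def eOp (n : ℕ) (s : Fin n) : Module.End ℝ ((Fin (n + 1) → Fin 4) → ℝ) :=
  if s.val % 2 = 1 then siteOp (Fin.ofNat (n + 1) s.val)
  else if s.val = 0 then bondOp (Fin.ofNat (n + 1) 0) (Fin.ofNat (n + 1) 3)
  else bondOp (Fin.ofNat (n + 1) (s.val - 1)) (Fin.ofNat (n + 1) (s.val + 1))

variable {n : ℕ}

theorem ofNat_ne {k l : ℕ} (hk : k ≤ n) (hl : l ≤ n) (h : k ≠ l) :
    Fin.ofNat (n + 1) k ≠ Fin.ofNat (n + 1) l := by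
  intro he
  have := congrArg Fin.val he
  simp only [Fin.val_ofNat] at this
  rw [Nat.mod_eq_of_lt (by omega), Nat.mod_eq_of_lt (by omega)] at this
  exact h this

/-- The endpoints of the bond of an even vertex. -/
def bondEnds (s : ℕ) : ℕ × ℕ := if s = 0 then (0, 3) else (s - 1, s + 1)

theorem eOp_odd {s : Fin n} (h : s.val % 2 = 1) : eOp n s = siteOp (Fin.ofNat (n + 1) s.val) := by
  rw [eOp, if_pos h]

theorem eOp_even {s : Fin n} (h : s.val % 2 = 0) : eOp n s =
    bondOp (Fin.ofNat (n + 1) (bondEnds s.val).1) (Fin.ofNat (n + 1) (bondEnds s.val).2) := by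
  rw [eOp, if_neg (by omega), bondEnds]
  split_ifs <;> rfl

theorem bondEnds_le (hn : 6 ≤ n) (s : Fin n) :
    (bondEnds s.val).1 ≤ n ∧ (bondEnds s.val).2 ≤ n ∧ (bondEnds s.val).1 ≠ (bondEnds s.val).2 := by
  unfold bondEnds
  split_ifs <;> simp <;> omega

/-- The tree is bipartite by parity, and adjacency becomes incidence of sites and bonds. The
relations for `E_n` thus reduce to those between site and bond operators. -/
theorem adj_iff_bondEnds {s t : Fin n} (hs : s.val % 2 = 1) (ht : t.val % 2 = 0) :
    TypeE.Adj n s t ↔ (bondEnds t.val).1 = s.val ∨ (bondEnds t.val).2 = s.val := by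
  unfold TypeE.Adj bondEnds
  split_ifs <;> simp <;> omega

theorem parity_of_adj {s t : Fin n} (h : TypeE.Adj n s t) : s.val % 2 ≠ t.val % 2 := by
  unfold TypeE.Adj at h
  omega

theorem eOp_sq (s : Fin n) : eOp n s * eOp n s = (2 : ℝ) • eOp n s := by
  rcases Nat.mod_two_eq_zero_or_one s.val with h | h
  · rw [eOp_even h, bondOp_sq]
  · rw [eOp_odd h, siteOp_sq]

theorem siteOp_eOp_comm (hn : 6 ≤ n) {c : ℕ} (hc : c ≤ n) {t : Fin n}
    (h : t.val % 2 = 0 → (bondEnds t.val).1 ≠ c ∧ (bondEnds t.val).2 ≠ c) :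
    siteOp (Fin.ofNat (n + 1) c) * eOp n t = eOp n t * siteOp (Fin.ofNat (n + 1) c) := by
  rcases Nat.mod_two_eq_zero_or_one t.val with ht | ht
  · obtain ⟨h1, h2, -⟩ := bondEnds_le hn t
    rw [eOp_even ht, siteOp_bondOp_comm (ofNat_ne h1 hc (h ht).1) (ofNat_ne h2 hc (h ht).2)]
  · rw [eOp_odd ht, siteOp_comm]

theorem stateOp_eOp_comm {c : ℕ} (hc : c ≤ n) (k : Fin 4) {t : Fin n}
    (h : t.val % 2 = 1 → c ≠ t.val) :
    stateOp (Fin.ofNat (n + 1) c) k * eOp n t = eOp n t * stateOp (Fin.ofNat (n + 1) c) k := by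
  rcases Nat.mod_two_eq_zero_or_one t.val with ht | ht
  · rw [eOp_even ht, stateOp_bondOp_comm]
  · rw [eOp_odd ht, stateOp_siteOp_comm (ofNat_ne hc t.2.le (h ht))]

theorem eOp_comm (hn : 6 ≤ n) {s t : Fin n} (h : ¬ TypeE.Adj n s t) :
    eOp n s * eOp n t = eOp n t * eOp n s := by
  have key : ∀ s t : Fin n, ¬ TypeE.Adj n s t → s.val % 2 = 1 →
      eOp n s * eOp n t = eOp n t * eOp n s := fun s t h hs => by
    rw [eOp_odd hs]
    refine siteOp_eOp_comm hn s.2.le fun ht => ?_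
    rw [adj_iff_bondEnds hs ht] at h
    tauto
  rcases Nat.mod_two_eq_zero_or_one s.val with hs | hs
  · rcases Nat.mod_two_eq_zero_or_one t.val with ht | ht
    · rw [eOp_even hs, eOp_even ht, bondOp_comm]
    · exact (key t s (fun h' => h h'.symm) ht).symm
  · exact key s t h hs

theorem eOp_braid (hn : 6 ≤ n) {s t : Fin n} (h : TypeE.Adj n s t) :
    eOp n s * eOp n t * eOp n s = eOp n s := by
  have hpar := parity_of_adj h
  rcases Nat.mod_two_eq_zero_or_one s.val with hs | hs
  · have ht : t.val % 2 = 1 := by omega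
    obtain ⟨h1, h2, h3⟩ := bondEnds_le hn s
    have h4 := ofNat_ne h1 h2 h3
    rw [eOp_even hs, eOp_odd ht]
    rcases (adj_iff_bondEnds ht hs).1 h.symm with h5 | h5
    · rw [← h5, bondOp_siteOp_bondOp h4]
    · rw [← h5, bondOp_symm, bondOp_siteOp_bondOp h4.symm]
  · have ht : t.val % 2 = 0 := by omega
    obtain ⟨h1, h2, h3⟩ := bondEnds_le hn t
    have h4 := ofNat_ne h1 h2 h3
    rw [eOp_even ht, eOp_odd hs]
    rcases (adj_iff_bondEnds hs ht).1 h with h5 | h5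
    · rw [← h5, siteOp_bondOp_siteOp h4]
    · rw [← h5, bondOp_symm, siteOp_bondOp_siteOp h4.symm]

theorem list_prod_comm {M : Type*} [Monoid M] {a : M} {l : List M} (h : ∀ b ∈ l, a * b = b * a) :
    a * l.prod = l.prod * a := Commute.list_prod_right l a h

/-- The matrices of the Potts representation of type `E n`. -/
def eMat (n : ℕ) (s : Fin n) : Matrix (Fin (n + 1) → Fin 4) (Fin (n + 1) → Fin 4) ℝ :=
  pottsMat (eOp n s)

theorem wordMat_eMat (ω : List (Fin n)) :
    wordMat (eMat n) ω = pottsMat (ω.map (eOp n)).prod := by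
  rw [map_list_prod, List.map_map]; rfl

theorem eMat_comm (hn : 6 ≤ n) (s t : Fin n) (h : ¬ (eGraph n).Adj s t) :
    eMat n s * eMat n t = eMat n t * eMat n s := by
  rw [eMat, eMat, ← map_mul, eOp_comm hn h, map_mul]

/-- Peels off the largest vertex of an antichain. For a site it suffices that the other operators
preserve the state there; a bond needs an end at which nothing else acts. -/
theorem ntr_eOp_mul (hn : 6 ≤ n) {s : Fin n} {A : List (Fin n)} (hlt : ∀ t ∈ A, t < s)
    (hadj : ∀ t ∈ A, ¬ TypeE.Adj n s t) :
    2 * ntr (pottsMat (eOp n s * (A.map (eOp n)).prod)) = ntr (pottsMat (A.map (eOp n)).prod) := by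
  have key1 : ∀ c ≤ n, (∀ t ∈ A, t.val % 2 = 1 → c ≠ t.val) → ∀ k,
      stateOp (Fin.ofNat (n + 1) c) k * (A.map (eOp n)).prod =
        (A.map (eOp n)).prod * stateOp (Fin.ofNat (n + 1) c) k := fun c hc h k => by
    refine list_prod_comm fun b hb => ?_
    obtain ⟨t, ht, rfl⟩ := List.mem_map.1 hb
    exact stateOp_eOp_comm hc k (h t ht)
  have key2 : ∀ c ≤ n,
      (∀ t ∈ A, t.val % 2 = 0 → (bondEnds t.val).1 ≠ c ∧ (bondEnds t.val).2 ≠ c) →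
      siteOp (Fin.ofNat (n + 1) c) * (A.map (eOp n)).prod =
        (A.map (eOp n)).prod * siteOp (Fin.ofNat (n + 1) c) := fun c hc h => by
    refine list_prod_comm fun b hb => ?_
    obtain ⟨t, ht, rfl⟩ := List.mem_map.1 hb
    exact siteOp_eOp_comm hn hc (h t ht)
  have hlt' : ∀ t ∈ A, t.val < s.val := hlt
  rcases Nat.mod_two_eq_zero_or_one s.val with hs | hs
  · obtain ⟨h1, h2, h3⟩ := bondEnds_le hn s
    have h4 := ofNat_ne h1 h2 h3
    rw [eOp_even hs]
    -- For `s ≥ 4` the end `s + 1` lies beyond the bonds of all smaller vertices. For `s = 2` the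
    -- site `3` is also an end of the bond of vertex `0`, so the end `1` is used; for `s = 0` it is
    -- the ghost site.
    by_cases h : s.val ≤ 2
    · refine ntr_bondOp_mul h4 (key1 _ h1 fun t ht hto he => ?_)
        (key2 _ h1 fun t ht hte => ?_)
      · exact hadj t ht ((adj_iff_bondEnds hto hs).2 (.inl he)).symm
      · have := hlt' t ht
        have e : t.val = 0 := by omega
        have e' : s.val = 2 := by omega
        simp [e, e', bondEnds]
    · rw [bondOp_symm]
      refine ntr_bondOp_mul h4.symm (key1 _ h2 fun t ht hto he => ?_)
        (key2 _ h2 fun t ht hte => ?_)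
      · exact hadj t ht ((adj_iff_bondEnds hto hs).2 (.inr he)).symm
      · have := hlt' t ht
        unfold bondEnds
        split_ifs <;> simp <;> omega
  · rw [eOp_odd hs]
    refine ntr_siteOp_mul (key1 _ s.2.le fun t ht _ he => ?_)
    have := hlt' t ht
    omega

theorem ntr_one : ntr (1 : Matrix (Fin (n + 1) → Fin 4) (Fin (n + 1) → Fin 4) ℝ) = 1 := by
  simp [ntr]

theorem isTLRep_eMat (hn : 6 ≤ n) : IsTLRep (eGraph n) (eMat n) where
  symm s := by
    rw [eMat]
    rcases Nat.mod_two_eq_zero_or_one s.val with h | h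
    · rw [eOp_even h, pottsMat_bondOp_transpose]
    · rw [eOp_odd h, pottsMat_siteOp_transpose]
  sq s := by rw [eMat, ← map_mul, eOp_sq, map_smul]
  comm s t h := eMat_comm hn s t h
  braid s t h := by rw [eMat, eMat, ← map_mul, ← map_mul, eOp_braid hn h]
  ntr_antichain A hA := by
    have key : ∀ A : List (Fin n), A.Pairwise (· > ·) → Antichain (eGraph n) A →
        2 ^ A.length * ntr (wordMat (eMat n) A) = 1 := by
      intro A
      induction A with
      | nil => intro _ _; simp [ntr_one]
      | cons a A ih =>
        intro hp hA
        rw [List.pairwise_cons] at hp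
        have h1 := ih hp.2 (List.pairwise_cons.1 hA).2
        have h2 := ntr_eOp_mul hn hp.1 fun t ht => ((List.pairwise_cons.1 hA).1 t ht).2
        rw [wordMat_eMat] at h1 ⊢
        rw [List.map_cons, List.prod_cons, List.length_cons, pow_succ, mul_assoc, h2, h1]
    have hperm : A.Perm (A.insertionSort (· ≥ ·)) := (List.perm_insertionSort _ A).symm
    have hA' := hA.perm hperm
    rw [wordMat_congr_of_comm (eMat_comm hn) (commEq_of_perm
      (fun a ha b hb => hA.not_adj ha hb) hperm), hperm.length_eq]
    refine key _ ?_ hA'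
    have hs := List.pairwise_insertionSort (r := fun a b : Fin n => a ≥ b) A
    exact (hs.and hA'.nodup).imp fun h => lt_of_le_of_ne h.1 (Ne.symm h.2)

end EPotts

/-! ### Reduction of words to antichains -/

section Reduction

variable {V : Type*} {G : SimpleGraph V}

theorem exists_split_of_proj_eq_false_cons {x : V} {w : List V} {l : List Bool}
    (h : proj G x w = false :: l) :
    ∃ y t z, w = y ++ t :: z ∧ G.Adj x t ∧ (∀ b ∈ y, ¬ G.Adj x b) ∧ proj G x z = l := by
  induction w with
  | nil => simp at h
  | cons a w ih =>
    by_cases ha : G.Adj x a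
    · rw [proj_cons_adj ha] at h
      exact ⟨[], a, w, rfl, ha, by simp, (List.cons.inj h).2⟩
    · by_cases hax : a = x
      · subst hax; simp at h
      · rw [proj_cons_other ha hax] at h
        obtain ⟨y, t, z, h1, h2, h3, h4⟩ := ih h
        exact ⟨a :: y, t, z, by simp [h1], h2, by simpa [ha] using h3, h4⟩

theorem exists_split_of_not_spaced {x : V} {ω : List V} (h : ¬ Spaced (proj G x ω)) :
    ∃ c d, ω = c ++ x :: d ∧ leadGap (proj G x d) < 2 := by
  induction ω with
  | nil => simp [Spaced] at h
  | cons a ω ih =>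
    by_cases hd : Spaced (proj G x ω)
    · by_cases hax : a = x
      · subst hax
        simp only [proj_cons_self, Spaced, hd, and_true, not_le] at h
        exact ⟨[], ω, rfl, h⟩
      · by_cases ha : G.Adj x a
        · rw [proj_cons_adj ha] at h; exact absurd hd h
        · rw [proj_cons_other ha hax] at h; exact absurd hd h
    · obtain ⟨c, d, h1, h2⟩ := ih hd
      exact ⟨a :: c, d, by simp [h1], h2⟩

/-- A word which is not an antichain has a rotation starting with two close occurrences of a
letter. -/
theorem exists_rotation (hF : ∀ r : List V, FCWord G (r ++ r) → r = []) {u : List V}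
    (hu : ¬ Antichain G u) : ∃ c x e, u = c ++ x :: e ∧ proj G x u ≠ [true] ∧
      leadGap (proj G x (e ++ c ++ [x])) < 2 := by
  classical
  set P : V → Bool := fun s => decide (proj G s u ≠ [true]) with hP
  set q := u.filter P with hq
  have hproj : ∀ x ∈ q, proj G x q = proj G x u := fun x hx => by
    rw [hq, List.mem_filter] at hx
    exact proj_filter_nonisolated P (by simp [hP]) hx.1 hx.2
  have hqne : q ≠ [] := by
    intro h
    refine hu (antichain_of_proj fun s hs => ?_)
    by_contra hne
    have : s ∈ q := List.mem_filter.2 ⟨hs, by simpa [hP] using hne⟩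
    simp [h] at this
  -- Without its isolated letters `u` is still nonempty, so some letter recurs too soon in the
  -- doubled word.
  have hnot : ¬ FCWord G (q ++ q) := fun h => hqne (hF q h)
  obtain ⟨x, hx⟩ := not_forall.1 hnot
  have hxq : x ∈ q := by
    by_contra hxq
    exact hx (spaced_of_notMem fun h => hxq (by simpa using true_mem_proj.1 h))
  have hiso : proj G x u ≠ [true] := by simpa [hP] using (List.mem_filter.1 hxq).2
  have hx' : ¬ Spaced (proj G x (u ++ u)) := by
    rwa [proj_append, ← hproj x hxq, ← proj_append]
  obtain ⟨c, d, hcd, hd⟩ := exists_split_of_not_spaced hx'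
  obtain ⟨c, e, hce, hlt⟩ : ∃ c e, u = c ++ x :: e ∧ leadGap (proj G x (e ++ u)) < 2 := by
    rcases List.append_eq_append_iff.1 hcd with ⟨c', h1, h2⟩ | ⟨e, h1, h2⟩
    · refine ⟨c', d, h2, ?_⟩
      rwa [proj_append, leadGap_append_of_mem (true_mem_proj.2 (mem_of_leadGap hd))]
    · rcases e with _ | ⟨a, e⟩
      · refine ⟨[], d, by simpa using h2.symm, ?_⟩
        rwa [proj_append, leadGap_append_of_mem (true_mem_proj.2 (mem_of_leadGap hd))]
      · obtain ⟨rfl, rfl⟩ := List.cons.inj h2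
        exact ⟨c, e, h1, hd⟩
  refine ⟨c, x, e, hce, hiso, ?_⟩
  have e1 : e ++ u = (e ++ c ++ [x]) ++ e := by rw [hce]; simp
  rwa [e1, proj_append, leadGap_append_of_mem (true_mem_proj.2 (by simp))] at hlt

/-- Every word is reduced to an antichain by rotations, commutations and the Temperley–Lieb
relations. -/
theorem word_induction (hF : ∀ r : List V, FCWord G (r ++ r) → r = []) {P : List V → Prop}
    (anti : ∀ A, Antichain G A → P A) (rot : ∀ x y, P (x ++ y) → P (y ++ x))
    (comm : ∀ x y, CommEq G x y → P x → P y) (sq : ∀ s y, P (s :: y) → P (s :: s :: y))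
    (braid : ∀ s t y, G.Adj s t → P (s :: y) → P (s :: t :: s :: y))
    (cancel : ∀ s y, P (s :: s :: y) → P (s :: y)) (u : List V) : P u := by
  induction hm : u.length using Nat.strong_induction_on generalizing u with
  | _ m ih =>
    by_cases hu : Antichain G u
    · exact anti u hu
    obtain ⟨c, x, e, hce, hiso, hlt⟩ := exists_rotation hF hu
    have hlen : u.length = (e ++ c).length + 1 := by rw [hce]; simp; omega
    have hrot : P (x :: (e ++ c)) → P u := fun h => by
      rw [hce]; exact rot (x :: e) c h
    have hw : proj G x (e ++ c) = [] → proj G x u = [true] := fun h => by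
      rw [proj_append, List.append_eq_nil_iff] at h
      simp [hce, h]
    generalize e ++ c = w at *
    apply hrot
    rw [proj_append] at hlt
    have hx1 : proj G x [x] = [true] := by simp
    by_cases hxw : x ∈ w
    · rw [leadGap_append_of_mem (true_mem_proj.2 hxw)] at hlt
      rcases Nat.lt_or_ge (leadGap (proj G x w)) 1 with h0 | h1
      · obtain ⟨z, hz⟩ := commEq_cons_of_leadGap (Nat.lt_one_iff.1 h0)
        exact comm _ _ (hz.cons x).symm
          (sq x z (ih (x :: z).length (by rw [← hm, hlen, hz.length_eq]; simp) _ rfl))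
      · obtain ⟨l, hl⟩ := leadGap_eq_one.1 (show leadGap (proj G x w) = 1 by omega)
        obtain ⟨y, t, v, rfl, hxt, hy, hv⟩ := exists_split_of_proj_eq_false_cons hl
        obtain ⟨z, hz⟩ := commEq_cons_of_leadGap (leadGap_eq_zero.2 ⟨l, hv⟩)
        have h1 : P (x :: t :: x :: (z ++ y)) := by
          refine braid x t _ hxt (ih (x :: (z ++ y)).length ?_ _ rfl)
          have := hz.length_eq
          simp only [List.length_append, List.length_cons] at this hlen ⊢
          omega
        have h2 : P (y ++ x :: t :: x :: z) := by
          simpa using rot (x :: t :: x :: z) y (by simpa using h1)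
        refine comm _ _ ?_ h2
        refine (CommEq.cons_middle hy _).trans ?_
        simpa using ((hz.symm.cons t).append_left y).cons x
    -- Cyclically, `x` is its own next occurrence, with a single neighbour `t` in between. Doubling
    -- `x` produces `x t x` up to rotation and commutation, and `cancel` undoes the doubling.
    · rw [leadGap_append_of_notMem fun h => hxw (true_mem_proj.1 h), hx1, leadGap, add_zero] at hlt
      have hne : proj G x w ≠ [] := fun h => hiso (hw h)
      obtain ⟨b, hb⟩ : ∃ b, proj G x w = [b] := List.length_eq_one_iff.1 (by
        have := List.length_pos_of_ne_nil hne; omega)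
      cases b
      swap
      · exact absurd (true_mem_proj.1 (hb ▸ List.mem_singleton_self true)) hxw
      obtain ⟨y, t, v, rfl, hxt, hy, hv⟩ := exists_split_of_proj_eq_false_cons hb
      have hvx : ∀ b ∈ v, ¬ G.Adj x b := fun b hb h => by
        have := false_mem_proj.2 ⟨b, hb, h⟩
        simp [hv] at this
      have h1 : P (x :: t :: x :: (v ++ y)) := by
        refine braid x t _ hxt (ih (x :: (v ++ y)).length ?_ _ rfl)
        simp only [List.length_append, List.length_cons] at hlen ⊢
        omega
      have h2 : P ((x :: t :: (v ++ y)) ++ [x]) := by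
        refine comm _ _ ?_ h1
        have h3 : CommEq G (v ++ y ++ [x]) (x :: (v ++ y)) := by
          simpa using CommEq.cons_middle (a := x) (x := v ++ y) (fun b hb => by
            rcases List.mem_append.1 hb with hb | hb
            · exact hvx b hb
            · exact hy b hb) []
        exact (h3.symm.cons t).cons x
      have h3 : P (x :: t :: (v ++ y)) := cancel _ _ (by simpa using rot _ _ h2)
      have h4 : P (y ++ x :: t :: v) := by simpa using rot (x :: t :: v) y (by simpa using h3)
      exact comm _ _ (.cons_middle hy _) h4

/-- Antichains have such a trace, and each move of `word_induction` multiplies it by a power of `2`.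
-/
theorem IsTLRep.exists_exponent {X : Type*} [Fintype X] [DecidableEq X] {B : V → Matrix X X ℝ}
    (h : IsTLRep G B) (hF : ∀ r : List V, FCWord G (r ++ r) → r = []) (u : List V) :
    ∃ e : ℤ, ntr (wordMat B u) = 2 ^ e := by
  refine word_induction hF (P := fun u => ∃ e : ℤ, ntr (wordMat B u) = 2 ^ e) ?_ ?_ ?_ ?_ ?_ ?_ u
  · intro A hA
    refine ⟨-(A.length : ℤ), ?_⟩
    rw [zpow_neg, zpow_natCast]
    exact eq_inv_of_mul_eq_one_right (h.ntr_antichain A hA)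
  · rintro x y ⟨e, he⟩
    exact ⟨e, by rw [wordMat_append, ntr_mul_comm, ← wordMat_append, he]⟩
  · rintro x y hxy ⟨e, he⟩
    exact ⟨e, by rw [← h.wordMat_congr hxy, he]⟩
  · rintro s y ⟨e, he⟩
    refine ⟨e + 1, ?_⟩
    rw [wordMat_cons, wordMat_cons, h.sq_mul, ntr_smul, ← wordMat_cons, he,
      zpow_add_one₀ two_ne_zero, mul_comm]
  · rintro s t y hst ⟨e, he⟩
    refine ⟨e, ?_⟩
    rw [wordMat_cons, wordMat_cons, wordMat_cons, h.braid_mul hst, ← wordMat_cons, he]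
  · rintro s y ⟨e, he⟩
    refine ⟨e - 1, ?_⟩
    rw [wordMat_cons, wordMat_cons, h.sq_mul, ntr_smul, ← wordMat_cons] at he
    rw [zpow_sub_one₀ two_ne_zero, ← he]
    ring

end Reduction

/-! ### The exchange property -/

noncomputable section Exchange

namespace CoxeterSystem

variable {B W : Type*} [Group W] {M : CoxeterMatrix B} (cs : CoxeterSystem M W)

open Classical in
/-- The action of a simple reflection on `W × ZMod 2`, conjugating the first component and changing
the second one at the reflection itself. -/
def signedConj (i : B) (p : W × ZMod 2) : W × ZMod 2 :=
  (cs.simple i * p.1 * cs.simple i, p.2 + if p.1 = cs.simple i then 1 else 0)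

/-- `signedConj` as an element of the monoid of self-maps. -/
def signedConjEnd (i : B) : Function.End (W × ZMod 2) := cs.signedConj i

theorem simple_conj_eq_iff (i : B) (t r : W) :
    cs.simple i * t * cs.simple i = r ↔ t = cs.simple i * r * cs.simple i := by
  constructor <;> rintro rfl <;> simp [mul_assoc]

/-- Along `(s_i s_j) ^ m` the second component collects the indicators of `m` reflections, each of
them twice, so they cancel modulo `2`. -/
theorem signedConj_liftable (hM : ∀ i j, M i j = 1 ∨ M i j = 2 ∨ M i j = 3) :
    M.IsLiftable cs.signedConjEnd := by
  classical
  intro i j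
  have hpow := cs.simple_mul_simple_pow i j
  have htwo : (2 : ZMod 2) = 0 := rfl
  have add_two : ∀ a b c : ZMod 2, a + b + c + b + c = a := fun a b c => by
    linear_combination (b + c) * htwo
  have add_three : ∀ a b c d : ZMod 2, a + b + c + d + b + c + d = a := fun a b c d => by
    linear_combination (b + c + d) * htwo
  rcases hM i j with h | h | h
  · have hij : i = j := by
      by_contra hne
      exact M.off_diagonal i j hne h
    subst hij
    rw [h, pow_one]
    funext p
    change cs.signedConj i (cs.signedConj i p) = p
    refine Prod.ext ?_ ?_
    · simp [signedConj, mul_assoc]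
    · simp only [signedConj, simple_conj_eq_iff, simple_mul_simple_self, one_mul]
      have := add_two p.2 (if p.1 = cs.simple i then 1 else 0) 0
      simpa using this
  · rw [h, pow_two] at hpow
    have hc : cs.simple i * cs.simple j = cs.simple j * cs.simple i := by
      have := eq_inv_of_mul_eq_one_left hpow
      simpa using this
    have h1 : cs.simple j * cs.simple i * cs.simple j = cs.simple i := by
      rw [← hc, simple_mul_simple_cancel_right]
    have h2 : cs.simple i * cs.simple j * cs.simple i = cs.simple j := by
      rw [hc, simple_mul_simple_cancel_right]
    rw [h, pow_two]
    funext p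
    change cs.signedConj i (cs.signedConj j (cs.signedConj i (cs.signedConj j p))) = p
    refine Prod.ext ?_ ?_
    · have e : ∀ t, cs.simple i * (cs.simple j * (cs.simple i * (cs.simple j * t * cs.simple j) *
          cs.simple i) * cs.simple j) * cs.simple i =
          (cs.simple i * cs.simple j * (cs.simple i * cs.simple j)) * t *
            (cs.simple i * cs.simple j * (cs.simple i * cs.simple j))⁻¹ := fun t => by
        simp [mul_assoc]
      simp only [signedConj]
      rw [e, hpow]
      simp
    · simp only [signedConj, simple_conj_eq_iff, h1, h2, simple_mul_simple_self, one_mul]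
      exact add_two _ _ _
  · rw [h, pow_succ, pow_two] at hpow
    have hb : cs.simple j * cs.simple i * cs.simple j = cs.simple i * cs.simple j * cs.simple i := by
      have h3 : cs.simple i * cs.simple j * cs.simple i * (cs.simple j * cs.simple i * cs.simple j)
          = 1 := by rw [← hpow]; simp only [mul_assoc]
      have := eq_inv_of_mul_eq_one_right h3
      simpa [mul_assoc] using this
    have h2 : cs.simple i * (cs.simple j * cs.simple i * cs.simple j) * cs.simple i
        = cs.simple j := by
      rw [hb]; simp [mul_assoc]
    have h3 : cs.simple j * (cs.simple i * cs.simple j * cs.simple i) * cs.simple j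
        = cs.simple i := by
      rw [← hb]; simp [mul_assoc]
    rw [h, pow_succ, pow_two]
    funext p
    change cs.signedConj i (cs.signedConj j (cs.signedConj i (cs.signedConj j
      (cs.signedConj i (cs.signedConj j p))))) = p
    refine Prod.ext ?_ ?_
    · have e : ∀ t, cs.simple i * (cs.simple j * (cs.simple i * (cs.simple j * (cs.simple i *
          (cs.simple j * t * cs.simple j) * cs.simple i) * cs.simple j) * cs.simple i) *
          cs.simple j) * cs.simple i =
          (cs.simple i * cs.simple j * (cs.simple i * cs.simple j) * (cs.simple i * cs.simple j))
            * t * (cs.simple i * cs.simple j * (cs.simple i * cs.simple j) *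
              (cs.simple i * cs.simple j))⁻¹ := fun t => by
        simp [mul_assoc]
      simp only [signedConj]
      rw [e, hpow]
      simp
    · simp only [signedConj, simple_conj_eq_iff, h2, h3, simple_mul_simple_self, one_mul]
      exact add_three _ _ _ _

open Classical in
-- The left side sees only the group element; so the parity with which `t` occurs in the inversion
-- sequence is independent of the word.
theorem lift_signedConj_apply (hM : ∀ i j, M i j = 1 ∨ M i j = 2 ∨ M i j = 3) (ω : List B)
    (t : W) : cs.lift ⟨_, cs.signedConj_liftable hM⟩ (cs.wordProd ω) (t, 0) =
      (cs.wordProd ω * t * (cs.wordProd ω)⁻¹, ((cs.rightInvSeq ω).count t : ZMod 2)) := by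
  induction ω with
  | nil => simp; rfl
  | cons i ω ih =>
    rw [wordProd_cons, map_mul]
    change cs.lift ⟨_, cs.signedConj_liftable hM⟩ (cs.simple i)
      (cs.lift ⟨_, cs.signedConj_liftable hM⟩ (cs.wordProd ω) (t, 0)) = _
    rw [ih, lift_apply_simple, rightInvSeq, List.count_cons]
    change cs.signedConj i _ = _
    rw [signedConj]
    refine Prod.ext ?_ ?_
    · simp [mul_assoc]
    · have e : cs.wordProd ω * t * (cs.wordProd ω)⁻¹ = cs.simple i ↔
          (cs.wordProd ω)⁻¹ * cs.simple i * cs.wordProd ω = t := by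
        rw [mul_inv_eq_iff_eq_mul, mul_assoc, inv_mul_eq_iff_eq_mul, eq_comm]
      simp only [e, beq_iff_eq]
      push_cast
      rfl

/-- The exchange property. -/
theorem simple_mem_rightInvSeq (hM : ∀ i j, M i j = 1 ∨ M i j = 2 ∨ M i j = 3) (ω : List B)
    {i : B} (h : cs.IsRightDescent (cs.wordProd ω) i) :
    cs.simple i ∈ cs.rightInvSeq ω := by
  classical
  -- Comparison with a reduced word of the same element that ends in `i`: its inversion sequence
  -- contains the simple reflection exactly once.
  obtain ⟨ω', h1, h2⟩ := cs.exists_isReduced (cs.wordProd ω * cs.simple i)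
  have h3 : cs.wordProd (ω' ++ [i]) = cs.wordProd ω := by
    rw [wordProd_append, ← h2]; simp
  have h4 : cs.IsReduced (ω' ++ [i]) := by
    rw [IsReduced, h3, List.length_append, ← h1.eq, ← h2]
    rw [isRightDescent_iff] at h
    simpa using h.symm
  have h5 : cs.simple i ∈ cs.rightInvSeq (ω' ++ [i]) := by
    rw [← List.concat_eq_append, rightInvSeq_concat]; simp
  have h6 := List.count_eq_one_of_mem h4.nodup_rightInvSeq h5
  have h7 := cs.lift_signedConj_apply hM (ω' ++ [i]) (cs.simple i)
  rw [h3, cs.lift_signedConj_apply hM ω, h6] at h7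
  have h8 := congrArg Prod.snd h7
  by_contra hn
  rw [List.count_eq_zero_of_not_mem hn] at h8
  simp at h8

theorem exists_eraseIdx (hM : ∀ i j, M i j = 1 ∨ M i j = 2 ∨ M i j = 3) (ω : List B)
    {i : B} (h : cs.IsRightDescent (cs.wordProd ω) i) :
    ∃ j < ω.length, cs.wordProd ω * cs.simple i = cs.wordProd (ω.eraseIdx j) := by
  obtain ⟨j, hj, he⟩ := List.mem_iff_getElem.1 (cs.simple_mem_rightInvSeq hM ω h)
  refine ⟨j, by simpa using hj, ?_⟩
  rw [← wordProd_mul_getD_rightInvSeq, List.getD_eq_getElem _ _ hj, he]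

end CoxeterSystem

end Exchange

/-! ### Reduced words of fully commutative elements -/

noncomputable section ReducedWords

variable {n : ℕ}

/-- If `B s = B t`, then for adjacent vertices `B s B t B s` would be `4 B s` instead of `B s`; for
non-adjacent ones the trace of `B s B t` would be `1` instead of `1/4`. -/
theorem IsTLRep.injective {V X : Type*} {G : SimpleGraph V} [Fintype X] [DecidableEq X]
    {B : V → Matrix X X ℝ} (h : IsTLRep G B) : Function.Injective B := by
  intro s t hst
  by_contra hne
  have h1 := h.ntr_antichain [s] (by simp [Antichain])
  by_cases hadj : G.Adj s t
  · have h2 := h.braid s t hadj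
    rw [← hst, h.sq, smul_mul_assoc, h.sq, smul_smul] at h2
    have h3 : (3 : ℝ) • B s = 0 := by
      rw [show (3 : ℝ) = 2 * 2 - 1 by norm_num, sub_smul, h2, one_smul, sub_self]
    have h4 := congrArg ntr h3
    simp only [wordMat_cons, wordMat_nil, mul_one, List.length_singleton, pow_one] at h1
    rw [ntr_smul] at h4
    simp only [ntr, Matrix.trace_zero, zero_div] at h4 h1
    linarith
  · have h2 := h.ntr_antichain [s, t] (by simp [Antichain, hne, hadj])
    simp only [wordMat_cons, wordMat_nil, mul_one, List.length_cons, List.length_nil, ← hst, h.sq,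
      ntr_smul] at h1 h2
    norm_num at h1 h2
    linarith

theorem coxeterMatrix_cases (n : ℕ) (i j : Fin n) : TypeE.coxeterMatrix n i j = 1 ∨
    TypeE.coxeterMatrix n i j = 2 ∨ TypeE.coxeterMatrix n i j = 3 := by
  change (Matrix.of _) i j = 1 ∨ (Matrix.of _) i j = 2 ∨ (Matrix.of _) i j = 3
  simp only [Matrix.of_apply]
  split_ifs <;> simp

theorem coxeterMatrix_adj {i j : Fin n} (h : TypeE.Adj n i j) : TypeE.coxeterMatrix n i j = 3 := by
  change (Matrix.of _) i j = 3
  simp [h, h.ne]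

theorem coxeterMatrix_eq_three {i j : Fin n} (h : TypeE.coxeterMatrix n i j = 3) :
    TypeE.Adj n i j := by
  change (Matrix.of _) i j = 3 at h
  simp only [Matrix.of_apply] at h
  split_ifs at h with h1 h2
  · omega
  · exact h2
  · omega

theorem coxeterMatrix_not_adj {i j : Fin n} (h : ¬ TypeE.Adj n i j) (hij : i ≠ j) :
    TypeE.coxeterMatrix n i j = 2 := by
  change (Matrix.of _) i j = 2
  simp [h, hij]

theorem coxeterMatrix_eq_two {i j : Fin n} (h : TypeE.coxeterMatrix n i j = 2) :
    ¬ TypeE.Adj n i j := fun h' => by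
  rw [coxeterMatrix_adj h'] at h
  omega

/-- At parameter `2` the elements `1 - B s` satisfy the Coxeter relations. This representation of
the Coxeter group serves to separate the simple reflections. -/
theorem eMat_liftable (hn : 6 ≤ n) :
    (TypeE.coxeterMatrix n).IsLiftable fun s => 1 - eMat n s := by
  intro i j
  have h := isTLRep_eMat hn
  have hsq : ∀ s, (1 - eMat n s) * (1 - eMat n s) = 1 := fun s => by
    rw [sub_mul, mul_sub, mul_sub, h.sq, two_smul]
    simp
  by_cases hij : i = j
  · subst hij
    rw [(TypeE.coxeterMatrix n).diagonal, pow_one, hsq]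
  by_cases ha : TypeE.Adj n i j
  · rw [coxeterMatrix_adj ha, pow_succ, pow_two]
    have key : ∀ s t, TypeE.Adj n s t → (1 - eMat n s) * (1 - eMat n t) * (1 - eMat n s) =
        1 - eMat n s - eMat n t + eMat n s * eMat n t + eMat n t * eMat n s := by
      intro s t hst
      have e : (1 - eMat n s) * (1 - eMat n t) * (1 - eMat n s) =
          1 - eMat n s - eMat n t + eMat n s * eMat n t + eMat n t * eMat n s
          + (eMat n s * eMat n s - (eMat n s + eMat n s))
          - (eMat n s * eMat n t * eMat n s - eMat n s) := by noncomm_ring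
      rw [e, h.sq, two_smul, h.braid s t hst]
      simp
    have e : (1 - eMat n i) * (1 - eMat n j) * (1 - eMat n i) =
        (1 - eMat n j) * (1 - eMat n i) * (1 - eMat n j) := by
      rw [key i j ha, key j i ha.symm]; abel
    calc (1 - eMat n i) * (1 - eMat n j) * ((1 - eMat n i) * (1 - eMat n j)) *
          ((1 - eMat n i) * (1 - eMat n j))
        = (1 - eMat n i) * (1 - eMat n j) * (1 - eMat n i) *
          ((1 - eMat n j) * (1 - eMat n i) * (1 - eMat n j)) := by simp only [mul_assoc]
      _ = (1 - eMat n i) * ((1 - eMat n j) * ((1 - eMat n i) * (1 - eMat n i)) * (1 - eMat n j)) *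
          (1 - eMat n i) := by rw [← e]; simp only [mul_assoc]
      _ = 1 := by rw [hsq, mul_one, hsq, mul_one, hsq]
  · rw [coxeterMatrix_not_adj ha hij, pow_two]
    have e : (1 - eMat n i) * (1 - eMat n j) = (1 - eMat n j) * (1 - eMat n i) := by
      rw [sub_mul, mul_sub, mul_sub, sub_mul, mul_sub, mul_sub, h.comm i j ha]
      simp only [one_mul, mul_one]
      abel
    calc (1 - eMat n i) * (1 - eMat n j) * ((1 - eMat n i) * (1 - eMat n j))
        = (1 - eMat n i) * ((1 - eMat n j) * (1 - eMat n j)) * (1 - eMat n i) := by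
          nth_rw 2 [e]; simp only [mul_assoc]
      _ = 1 := by rw [hsq, mul_one, hsq]

theorem simple_injective (hn : 6 ≤ n) : Function.Injective (TypeE.cs n).simple := by
  intro i j hij
  have h := congrArg ((TypeE.cs n).lift ⟨_, eMat_liftable hn⟩) hij
  rw [CoxeterSystem.lift_apply_simple, CoxeterSystem.lift_apply_simple] at h
  exact (isTLRep_eMat hn).injective (sub_right_injective h)

theorem simple_comm {i j : Fin n} (h : ¬ TypeE.Adj n i j) :
    (TypeE.cs n).simple i * (TypeE.cs n).simple j = (TypeE.cs n).simple j * (TypeE.cs n).simple i := by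
  by_cases hij : i = j
  · rw [hij]
  have hpow := (TypeE.cs n).simple_mul_simple_pow i j
  rw [coxeterMatrix_not_adj h hij, pow_two] at hpow
  have := eq_inv_of_mul_eq_one_left hpow
  rwa [mul_inv_rev, CoxeterSystem.inv_simple, CoxeterSystem.inv_simple] at this

theorem simple_braid {i j : Fin n} (h : TypeE.Adj n i j) :
    (TypeE.cs n).simple i * (TypeE.cs n).simple j * (TypeE.cs n).simple i =
      (TypeE.cs n).simple j * (TypeE.cs n).simple i * (TypeE.cs n).simple j := by
  have hpow := (TypeE.cs n).simple_mul_simple_pow i j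
  rw [coxeterMatrix_adj h, pow_succ, pow_two] at hpow
  have e : (TypeE.cs n).simple i * (TypeE.cs n).simple j * (TypeE.cs n).simple i *
      ((TypeE.cs n).simple j * (TypeE.cs n).simple i * (TypeE.cs n).simple j) = 1 := by
    rw [← hpow]; simp only [mul_assoc]
  have := eq_inv_of_mul_eq_one_left e
  simpa only [mul_inv_rev, CoxeterSystem.inv_simple, ← mul_assoc] using this

theorem wordProd_congr {x y : List (Fin n)} (h : CommEq (eGraph n) x y) :
    (TypeE.cs n).wordProd x = (TypeE.cs n).wordProd y := by
  induction h with
  | refl x => rfl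
  | swap x hab y =>
    simp only [CoxeterSystem.wordProd_append, CoxeterSystem.wordProd_cons, ← mul_assoc
      ((TypeE.cs n).simple _) ((TypeE.cs n).simple _), simple_comm hab]
  | trans _ _ h1 h2 => exact h1.trans h2

theorem isReduced_congr {x y : List (Fin n)} (h : CommEq (eGraph n) x y)
    (hx : (TypeE.cs n).IsReduced x) : (TypeE.cs n).IsReduced y := by
  rw [CoxeterSystem.IsReduced, ← wordProd_congr h, ← h.length_eq]
  exact hx

theorem isReduced_left {x y : List (Fin n)} (h : (TypeE.cs n).IsReduced (x ++ y)) :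
    (TypeE.cs n).IsReduced x := by simpa using h.take x.length

theorem isReduced_right {x y : List (Fin n)} (h : (TypeE.cs n).IsReduced (x ++ y)) :
    (TypeE.cs n).IsReduced y := by simpa using h.drop x.length

/-- The inversion sequence of an antichain is the list of its own generators, so by exchange a drop
in length would identify two simple reflections. -/
theorem isReduced_antichain (hn : 6 ≤ n) {A : List (Fin n)} (hA : Antichain (eGraph n) A) :
    (TypeE.cs n).IsReduced A := by
  induction A using List.reverseRecOn with
  | nil => simp [CoxeterSystem.IsReduced]
  | append_singleton A a ih =>
    have hA' : Antichain (eGraph n) A := (List.pairwise_append.1 hA).1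
    have hred := ih hA'
    rw [CoxeterSystem.IsReduced, CoxeterSystem.wordProd_append, CoxeterSystem.wordProd_singleton,
      List.length_append, List.length_singleton, ← hred.eq]
    rcases (TypeE.cs n).length_mul_simple ((TypeE.cs n).wordProd A) a with h | h
    · exact h
    exfalso
    have hmem := (TypeE.cs n).simple_mem_rightInvSeq (coxeterMatrix_cases n) A
      ((TypeE.cs n).isRightDescent_iff.2 h)
    have hris : ∀ A : List (Fin n), Antichain (eGraph n) A →
        (TypeE.cs n).rightInvSeq A = A.map (TypeE.cs n).simple := by
      intro A
      induction A with
      | nil => simp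
      | cons b A ih =>
        intro hA
        have hc : CommEq (eGraph n) (A ++ [b]) (b :: A) := by
          simpa using CommEq.cons_middle (a := b) (x := A)
            (fun c hc => hA.not_adj (by simp) (by simp [hc])) []
        have hc' := wordProd_congr hc
        rw [CoxeterSystem.wordProd_append, CoxeterSystem.wordProd_singleton,
          CoxeterSystem.wordProd_cons] at hc'
        rw [CoxeterSystem.rightInvSeq, ih (List.pairwise_cons.1 hA).2, mul_assoc, ← hc',
          inv_mul_cancel_left, List.map_cons]
    rw [hris A hA'] at hmem
    obtain ⟨b, hb, hab⟩ := List.mem_map.1 hmem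
    have := simple_injective hn hab
    subst this
    exact (List.nodup_append.1 hA.nodup).2.2 b hb b (by simp) rfl

/-- A reduced word containing `i j i` for adjacent `i`, `j` represents a complex element. -/
theorem isComplex_of_isReduced {x y : List (Fin n)} {i j : Fin n} (hij : TypeE.Adj n i j)
    (h : (TypeE.cs n).IsReduced (x ++ [i, j, i] ++ y)) :
    TypeE.IsComplex n ((TypeE.cs n).wordProd (x ++ [i, j, i] ++ y)) := by
  have e : (TypeE.cs n).wordProd [i, j, i] =
      (TypeE.cs n).simple i * (TypeE.cs n).simple j * (TypeE.cs n).simple i := by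
    simp [CoxeterSystem.wordProd_cons, mul_assoc]
  refine ⟨(TypeE.cs n).wordProd x, (TypeE.cs n).wordProd y, i, j, hij, ?_, ?_⟩
  · rw [← e, CoxeterSystem.wordProd_append, CoxeterSystem.wordProd_append]
  · rw [← e, h.eq, (isReduced_left (isReduced_left h)).eq, (isReduced_right h).eq,
      (isReduced_right (isReduced_left h)).eq]
    simp only [List.length_append]

theorem not_isReduced_square (x y : List (Fin n)) (i : Fin n) :
    ¬ (TypeE.cs n).IsReduced (x ++ [i, i] ++ y) := by
  intro h
  have := (isReduced_right (isReduced_left h)).eq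
  rw [CoxeterSystem.wordProd_cons, CoxeterSystem.wordProd_singleton,
    CoxeterSystem.simple_mul_simple_self, CoxeterSystem.length_one] at this
  simp at this

/-- Two occurrences of `s` that are too close can be commuted into `s s`, which is not reduced, or
`s t s`, which makes the element complex. -/
theorem fcWord_of_isReduced {ω : List (Fin n)} (hω : (TypeE.cs n).IsReduced ω)
    (h : TypeE.IsFullyCommutative n ((TypeE.cs n).wordProd ω)) : FCWord (eGraph n) ω := by
  intro s
  by_contra hs
  obtain ⟨c, d, rfl, hlt⟩ := exists_split_of_not_spaced hs
  rcases Nat.lt_or_ge (leadGap (proj (eGraph n) s d)) 1 with h0 | h1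
  · obtain ⟨z, hz⟩ := commEq_cons_of_leadGap (Nat.lt_one_iff.1 h0)
    refine not_isReduced_square c z s ?_
    simpa using isReduced_congr ((hz.cons s).append_left c) hω
  · obtain ⟨l, hl⟩ := leadGap_eq_one.1 (show leadGap (proj (eGraph n) s d) = 1 by omega)
    obtain ⟨y, t, v, rfl, hst, hy, hv⟩ := exists_split_of_proj_eq_false_cons hl
    obtain ⟨z, hz⟩ := commEq_cons_of_leadGap (leadGap_eq_zero.2 ⟨l, hv⟩)
    have hc : CommEq (eGraph n) (c ++ s :: (y ++ t :: v)) (c ++ y ++ [s, t, s] ++ z) := by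
      have h1 : CommEq (eGraph n) (s :: (y ++ t :: v)) (y ++ s :: t :: v) :=
        (CommEq.cons_middle hy _).symm
      simpa using (h1.trans (((hz.cons t).cons s).append_left y)).append_left c
    rw [wordProd_congr hc] at h
    exact h (isComplex_of_isReduced hst (isReduced_congr hc hω))

/-- Two reduced words for the same element are related by commutations if no reduced word for it
contains `i j i` with adjacent `i`, `j`. -/
theorem commEq_of_isReduced (hn : 6 ≤ n) {ω ω' : List (Fin n)} (h : (TypeE.cs n).IsReduced ω)
    (h' : (TypeE.cs n).IsReduced ω') (he : (TypeE.cs n).wordProd ω = (TypeE.cs n).wordProd ω')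
    (hfc : ∀ x y i j, TypeE.Adj n i j → (TypeE.cs n).IsReduced (x ++ [i, j, i] ++ y) →
      (TypeE.cs n).wordProd (x ++ [i, j, i] ++ y) ≠ (TypeE.cs n).wordProd ω) :
    CommEq (eGraph n) ω ω' := by
  induction hm : ω.length generalizing ω ω' with
  | zero =>
    have hl : ω'.length = 0 := by rw [← h'.eq, ← he, h.eq, hm]
    rw [List.length_eq_zero_iff.1 hm, List.length_eq_zero_iff.1 hl]
    exact .refl _
  | succ m ih =>
    have hlen : ω'.length = m + 1 := by rw [← h'.eq, ← he, h.eq, hm]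
    obtain ⟨α, s, rfl⟩ := (List.eq_nil_or_concat' ω).resolve_left (by rintro rfl; simp at hm)
    obtain ⟨β, t, rfl⟩ := (List.eq_nil_or_concat' ω').resolve_left (by rintro rfl; simp at hlen)
    have hα := isReduced_left h
    have hβ := isReduced_left h'
    have hαm : α.length = m := by simpa using hm
    have hβm : β.length = m := by simpa using hlen
    set w := (TypeE.cs n).wordProd (α ++ [s]) with hw
    have hwlen : (TypeE.cs n).length w = m + 1 := by rw [hw, h.eq, hm]
    have hwα : w = (TypeE.cs n).wordProd α * (TypeE.cs n).simple s := by
      rw [hw, CoxeterSystem.wordProd_append, CoxeterSystem.wordProd_singleton]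
    have hwβ : w = (TypeE.cs n).wordProd β * (TypeE.cs n).simple t := by
      rw [he, CoxeterSystem.wordProd_append, CoxeterSystem.wordProd_singleton]
    -- The hypothesis is inherited by prefixes: a forbidden word for the prefix, followed by `r`,
    -- would be one for `w`.
    have hfc' : ∀ γ r, (TypeE.cs n).IsReduced γ → γ.length = m →
        w = (TypeE.cs n).wordProd γ * (TypeE.cs n).simple r → ∀ x y i j, TypeE.Adj n i j →
        (TypeE.cs n).IsReduced (x ++ [i, j, i] ++ y) →
        (TypeE.cs n).wordProd (x ++ [i, j, i] ++ y) ≠ (TypeE.cs n).wordProd γ := by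
      intro γ r hγ hγm hγw x y i j hij hred hcon
      have e : (TypeE.cs n).wordProd (x ++ [i, j, i] ++ (y ++ [r])) = w := by
        rw [← List.append_assoc, CoxeterSystem.wordProd_append, hcon, hγw,
          CoxeterSystem.wordProd_singleton]
      refine hfc x (y ++ [r]) i j hij ?_ e
      have e2 := hred.eq
      rw [hcon, hγ.eq, hγm] at e2
      rw [CoxeterSystem.IsReduced, e, hwlen, ← List.append_assoc, List.length_append, ← e2]
      rfl
    by_cases hst : s = t
    · subst hst
      exact (ih hα hβ (mul_right_cancel (hwα.symm.trans hwβ)) (hfc' α s hα hαm hwα) hαm).append_right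
        [s]
    have hne : (TypeE.cs n).simple s ≠ (TypeE.cs n).simple t := fun h => hst (simple_injective hn h)
    have hdesc : (TypeE.cs n).IsRightDescent w t := by
      rw [CoxeterSystem.IsRightDescent, hwlen, hwβ, CoxeterSystem.simple_mul_simple_cancel_right,
        hβ.eq, hβm]
      omega
    -- By exchange `w t` arises from `α s` by deleting a letter. This is not the final `s`, as `s ≠
    -- t`, so `w = γ s t`.
    obtain ⟨j, hj, hej⟩ := (TypeE.cs n).exists_eraseIdx (coxeterMatrix_cases n) (α ++ [s]) hdesc
    rw [← hw, hwβ, CoxeterSystem.simple_mul_simple_cancel_right] at hej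
    rw [List.length_append, List.length_singleton] at hj
    rcases Nat.lt_or_ge j α.length with hjlt | hjge
    swap
    · rw [List.eraseIdx_append_of_length_le hjge, show j - α.length = 0 by omega] at hej
      simp only [List.eraseIdx_cons_zero, List.append_nil] at hej
      rw [hwα, hej] at hwβ
      exact absurd (mul_left_cancel hwβ) hne
    rw [List.eraseIdx_append_of_lt_length hjlt] at hej
    set γ := α.eraseIdx j with hγ
    have hγm : γ.length + 1 = m := by
      rw [hγ, List.length_eraseIdx_of_lt hjlt]; omega
    have hwγ : w = (TypeE.cs n).wordProd γ * (TypeE.cs n).simple s * (TypeE.cs n).simple t := by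
      rw [hwβ, hej, CoxeterSystem.wordProd_append, CoxeterSystem.wordProd_singleton]
    have hγs : (TypeE.cs n).IsReduced (γ ++ [s]) := by
      rw [CoxeterSystem.IsReduced, ← hej, hβ.eq, hβm]; simp [hγm]
    have h1 : CommEq (eGraph n) (γ ++ [s]) β := by
      refine ih hγs hβ hej.symm (hfc' _ t hγs (by simp [hγm]) ?_) (by simp [hγm])
      rw [hwγ, CoxeterSystem.wordProd_append, CoxeterSystem.wordProd_singleton]
    by_cases hadj : TypeE.Adj n s t
    swap
    · have e : (TypeE.cs n).wordProd α = (TypeE.cs n).wordProd (γ ++ [t]) := by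
        rw [mul_assoc, simple_comm hadj, ← mul_assoc, hwα] at hwγ
        rw [CoxeterSystem.wordProd_append, CoxeterSystem.wordProd_singleton]
        exact mul_right_cancel hwγ
      have hγt : (TypeE.cs n).IsReduced (γ ++ [t]) := by
        rw [CoxeterSystem.IsReduced, ← e, hα.eq, hαm]; simp [hγm]
      have h2 := ih hα hγt e (hfc' α s hα hαm hwα) hαm
      have h3 : CommEq (eGraph n) (γ ++ [t] ++ [s]) (γ ++ [s] ++ [t]) := by
        simpa using CommEq.swap (G := eGraph n) γ (fun h => hadj h.symm) []
      exact (h2.append_right [s]).trans (h3.trans (h1.append_right [t]))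
    exfalso
    have hst_word : (TypeE.cs n).wordProd (γ ++ [s, t]) = w := by
      rw [hwγ, CoxeterSystem.wordProd_append, CoxeterSystem.wordProd_cons,
        CoxeterSystem.wordProd_singleton, mul_assoc]
    -- A second exchange, now for adjacent `s` and `t`. A deletion inside `γ` exhibits a reduced
    -- word of `w` ending in `s t s`, which is excluded; deleting `s` or `t` would make the two
    -- reflections equal.
    have hdesc' : (TypeE.cs n).IsRightDescent ((TypeE.cs n).wordProd (γ ++ [s, t])) s := by
      rw [hst_word, CoxeterSystem.IsRightDescent, hwlen, hwα,
        CoxeterSystem.simple_mul_simple_cancel_right, hα.eq, hαm]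
      omega
    obtain ⟨k, hk, hek⟩ := (TypeE.cs n).exists_eraseIdx (coxeterMatrix_cases n) _ hdesc'
    rw [List.length_append, List.length_cons, List.length_singleton] at hk
    rw [CoxeterSystem.wordProd_append, CoxeterSystem.wordProd_cons,
      CoxeterSystem.wordProd_singleton] at hek
    rcases Nat.lt_or_ge k γ.length with hklt | hkge
    · rw [List.eraseIdx_append_of_lt_length hklt] at hek
      have e : (TypeE.cs n).wordProd (γ.eraseIdx k ++ [s, t, s] ++ []) = w := by
        rw [List.append_nil, show γ.eraseIdx k ++ [s, t, s] = (γ.eraseIdx k ++ [s, t]) ++ [s] by simp,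
          CoxeterSystem.wordProd_append, ← hek, CoxeterSystem.wordProd_singleton,
          CoxeterSystem.simple_mul_simple_cancel_right, hwγ, mul_assoc]
      refine hfc _ _ s t hadj ?_ e
      rw [CoxeterSystem.IsReduced, e, hwlen]
      simp only [List.length_append, List.length_eraseIdx_of_lt hklt, List.length_cons,
        List.length_nil]
      omega
    · rw [List.eraseIdx_append_of_length_le hkge] at hek
      obtain h0 | h0 : k - γ.length = 0 ∨ k - γ.length = 1 := by omega
      · rw [h0, List.eraseIdx_cons_zero, CoxeterSystem.wordProd_append,
          CoxeterSystem.wordProd_singleton, mul_assoc] at hek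
        have h4 := mul_left_cancel hek
        rw [simple_braid hadj] at h4
        have h5 : (TypeE.cs n).simple s * (TypeE.cs n).simple t = 1 := by
          rw [mul_assoc] at h4
          exact mul_eq_left.1 h4
        have h6 := eq_inv_of_mul_eq_one_left h5
        rw [CoxeterSystem.inv_simple] at h6
        exact hne h6
      · rw [h0, List.eraseIdx_cons_succ, List.eraseIdx_cons_zero, CoxeterSystem.wordProd_append,
          CoxeterSystem.wordProd_singleton, mul_assoc] at hek
        have h4 := mul_left_cancel hek
        rw [mul_assoc] at h4
        have h6 := eq_inv_of_mul_eq_one_left (mul_eq_left.1 h4)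
        rw [CoxeterSystem.inv_simple] at h6
        exact hne h6.symm

theorem commEq_of_isReducedExpression (hn : 6 ≤ n) {w : TypeE.W n}
    (hw : TypeE.IsFullyCommutative n w) {ω ω' : List (Fin n)}
    (h : TypeE.IsReducedExpression n ω w) (h' : TypeE.IsReducedExpression n ω' w) :
    CommEq (eGraph n) ω ω' := by
  refine commEq_of_isReduced hn h.1 h'.1 (h.2.trans h'.2.symm) fun x y i j hij hred he => hw ?_
  rw [← h.2, ← he]
  exact isComplex_of_isReduced hij hred

end ReducedWords

/-! ### The exponent of the trace -/

noncomputable section TraceExponent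

variable {n : ℕ}

/-- The exponent of `2` in the normalized trace of a product of the matrices `eMat n`. -/
def traceExp (n : ℕ) (ω : List (Fin n)) : ℤ := Int.log 2 (ntr (wordMat (eMat n) ω))

theorem fcWord_append_self (hn : 6 ≤ n) (r : List (Fin n)) (h : FCWord (eGraph n) (r ++ r)) :
    r = [] := eq_nil_of_fcWord_append_self (by omega) h

theorem ntr_eq_zpow (hn : 6 ≤ n) (ω : List (Fin n)) :
    ntr (wordMat (eMat n) ω) = 2 ^ traceExp n ω := by
  obtain ⟨e, he⟩ := (isTLRep_eMat hn).exists_exponent (fcWord_append_self hn) ω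
  have h : Int.log 2 ((2 : ℝ) ^ e) = e := by
    simpa using Int.log_zpow (R := ℝ) (b := 2) (by norm_num) e
  rw [traceExp, he, h]

/-- Turns identities between real traces at parameter `2` into identities between exponents, which
can then be used for any `δ`. -/
theorem traceExp_eq (hn : 6 ≤ n) {x y : List (Fin n)} {k : ℤ}
    (h : ntr (wordMat (eMat n) x) = 2 ^ k * ntr (wordMat (eMat n) y)) :
    traceExp n x = k + traceExp n y := by
  rw [ntr_eq_zpow hn, ntr_eq_zpow hn, ← zpow_add₀ two_ne_zero] at h
  exact zpow_right_injective₀ two_pos (by norm_num) h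

theorem traceExp_append_comm (hn : 6 ≤ n) (x y : List (Fin n)) :
    traceExp n (x ++ y) = traceExp n (y ++ x) := by
  have h := traceExp_eq hn (x := x ++ y) (y := y ++ x) (k := 0)
    (by rw [zpow_zero, one_mul, wordMat_append, ntr_mul_comm, ← wordMat_append])
  rwa [zero_add] at h

theorem traceExp_congr (hn : 6 ≤ n) {x y : List (Fin n)} (h : CommEq (eGraph n) x y) :
    traceExp n x = traceExp n y := by
  rw [traceExp, traceExp, (isTLRep_eMat hn).wordMat_congr h]

theorem traceExp_sq (hn : 6 ≤ n) (x y : List (Fin n)) (s : Fin n) :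
    traceExp n (x ++ s :: s :: y) = 1 + traceExp n (x ++ s :: y) := by
  refine traceExp_eq hn ?_
  rw [wordMat_append, wordMat_append, wordMat_cons, wordMat_cons, (isTLRep_eMat hn).sq_mul,
    mul_smul_comm, ntr_smul, zpow_one]

theorem traceExp_braid (hn : 6 ≤ n) (x y : List (Fin n)) {s t : Fin n} (h : TypeE.Adj n s t) :
    traceExp n (x ++ s :: t :: s :: y) = traceExp n (x ++ s :: y) := by
  have h := traceExp_eq hn (x := x ++ s :: t :: s :: y) (y := x ++ s :: y) (k := 0) (by
    rw [zpow_zero, one_mul, wordMat_append, wordMat_append, wordMat_cons, wordMat_cons,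
      wordMat_cons, (isTLRep_eMat hn).braid_mul h])
  rwa [zero_add] at h

theorem two_pow_mul_ntr (hn : 6 ≤ n) (k : ℕ) (ω : List (Fin n)) :
    2 ^ k * ntr (wordMat (eMat n) ω) = 2 ^ ((k : ℤ) + traceExp n ω) := by
  rw [zpow_add₀ two_ne_zero, zpow_natCast, ntr_eq_zpow hn]

theorem two_pow_mul_ntr_eq_one_iff (hn : 6 ≤ n) {k : ℕ} {ω : List (Fin n)} :
    2 ^ k * ntr (wordMat (eMat n) ω) = 1 ↔ traceExp n ω = -(k : ℤ) := by
  rw [two_pow_mul_ntr hn, zpow_eq_one_iff_right₀ zero_le_two (by norm_num)]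
  omega

theorem two_pow_mul_ntr_le_one_iff (hn : 6 ≤ n) {k : ℕ} {ω : List (Fin n)} :
    2 ^ k * ntr (wordMat (eMat n) ω) ≤ 1 ↔ traceExp n ω ≤ -(k : ℤ) := by
  rw [two_pow_mul_ntr hn, zpow_le_one_iff_right₀ one_lt_two]
  omega

theorem traceExp_antichain (hn : 6 ≤ n) {A : List (Fin n)} (hA : Antichain (eGraph n) A) :
    traceExp n A = -(A.length : ℤ) :=
  (two_pow_mul_ntr_eq_one_iff hn).1 ((isTLRep_eMat hn).ntr_antichain A hA)

theorem antichain_wordOf {A : Finset (Fin n)} (hA : TypeE.IsIndependent n A) :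
    Antichain (eGraph n) (TypeE.wordOf n A) :=
  antichain_of (Finset.sort_nodup _ _) fun a ha b hb =>
    hA a ((Finset.mem_sort _).1 ha) b ((Finset.mem_sort _).1 hb)

theorem length_wordOf (A : Finset (Fin n)) : (TypeE.wordOf n A).length = A.card :=
  Finset.length_sort _

theorem Antichain.exists_wordOf {A : List (Fin n)} (hA : Antichain (eGraph n) A) :
    ∃ S : Finset (Fin n), TypeE.IsIndependent n S ∧ CommEq (eGraph n) A (TypeE.wordOf n S) := by
  refine ⟨A.toFinset, fun i hi j hj => hA.not_adj (List.mem_toFinset.1 hi) (List.mem_toFinset.1 hj),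
    commEq_of_perm (fun a ha b hb => hA.not_adj ha hb) ?_⟩
  refine List.perm_of_nodup_nodup_toFinset_eq hA.nodup (Finset.sort_nodup _ _) ?_
  rw [TypeE.wordOf, Finset.sort_toFinset]

end TraceExponent

/-! ### Linear maps on algebras given by generators and relations -/

noncomputable section WordFunctional

variable {R X M : Type*} [CommRing R] [AddCommGroup M] [Module R M]

namespace FreeAlgebra

theorem basisFreeMonoid_apply (ω : FreeMonoid X) :
    basisFreeMonoid R X ω = (ω.toList.map (ι R)).prod := by
  simp [basisFreeMonoid, equivMonoidAlgebraFreeMonoid, FreeMonoid.lift_apply]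

/-- The linear map on the free algebra with given values on words. -/
def wordFunctional (g : List X → M) : FreeAlgebra R X →ₗ[R] M :=
  (basisFreeMonoid R X).constr R fun ω => g ω.toList

theorem wordFunctional_word (g : List X → M) (ω : List X) :
    wordFunctional (R := R) g (ω.map (ι R)).prod = g ω := by
  have h := (basisFreeMonoid R X).constr_basis R (fun ω => g ω.toList) (FreeMonoid.ofList ω)
  rwa [basisFreeMonoid_apply] at h

theorem ext_words {N : Type*} [AddCommGroup N] [Module R N] {f g : FreeAlgebra R X →ₗ[R] N}
    (h : ∀ ω : List X, f (ω.map (ι R)).prod = g (ω.map (ι R)).prod) : f = g :=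
  (basisFreeMonoid R X).ext fun ω => by rw [basisFreeMonoid_apply]; exact h _

theorem map_mul_mul_of_words {f : FreeAlgebra R X →ₗ[R] M} {a c : FreeAlgebra R X}
    (h : ∀ x y : List X, f ((x.map (ι R)).prod * a * (y.map (ι R)).prod) =
      f ((x.map (ι R)).prod * c * (y.map (ι R)).prod)) (y z : FreeAlgebra R X) :
    f (y * a * z) = f (y * c * z) := by
  have h1 : ∀ (x : List X) z, f ((x.map (ι R)).prod * a * z) = f ((x.map (ι R)).prod * c * z) :=
    fun x => LinearMap.congr_fun (f := f ∘ₗ LinearMap.mulLeft R ((x.map (ι R)).prod * a))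
      (g := f ∘ₗ LinearMap.mulLeft R ((x.map (ι R)).prod * c)) (ext_words (h x))
  have h2 := LinearMap.congr_fun (f := f ∘ₗ LinearMap.mulRight R (a * z))
    (g := f ∘ₗ LinearMap.mulRight R (c * z)) (ext_words fun x => by
      simpa only [LinearMap.comp_apply, LinearMap.mulRight_apply, mul_assoc] using h1 x z) y
  simpa only [LinearMap.comp_apply, LinearMap.mulRight_apply, mul_assoc] using h2

end FreeAlgebra

/-- A linear map which respects the two-sided multiples of the relations descends to the
quotient ring. -/
theorem RingQuot.exists_linearMap {A : Type*} [Ring A] [Algebra R A] {r : A → A → Prop}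
    (f : A →ₗ[R] M) (h : ∀ a b, r a b → ∀ y z, f (y * a * z) = f (y * b * z)) :
    ∃ g : RingQuot r →ₗ[R] M, ∀ a, g (RingQuot.mkAlgHom R r a) = f a := by
  have hrel : ∀ a b, RingQuot.Rel r a b → ∀ y z, f (y * a * z) = f (y * b * z) := by
    intro a b hab
    induction hab with
    | of hab => exact h _ _ hab
    | add_left _ ih => intro y z; simp only [mul_add, add_mul, map_add, ih]
    | mul_left _ ih => intro y z; simpa only [mul_assoc] using ih y (_ * z)
    | mul_right _ ih => intro y z; simpa only [mul_assoc] using ih (y * _) z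
  have hker : ∀ a, RingQuot.mkAlgHom R r a = 0 → f a = 0 := by
    intro a ha
    rw [← map_zero (RingQuot.mkAlgHom R r), RingQuot.mkAlgHom_def] at ha
    simp only [RingQuot.mkRingHom_def] at ha
    -- Equality in the quotient is the equivalence generated by `RingQuot.Rel`, and `f` is constant
    -- along it by `hrel`.
    have ha' := Quot.eqvGen_exact (congrArg RingQuot.toQuot ha)
    clear ha
    rw [← map_zero f]
    generalize (0 : A) = c at ha' ⊢
    induction ha' with
    | rel a b hab => simpa using hrel a b hab 1 1
    | refl => rfl
    | symm _ _ _ ih => exact ih.symm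
    | trans _ _ _ _ _ ih1 ih2 => exact ih1.trans ih2
  let q : A →ₗ[R] RingQuot r := (RingQuot.mkAlgHom R r).toLinearMap
  have hle : LinearMap.ker q ≤ LinearMap.ker f := fun a ha => hker a ha
  have hq : Function.Surjective q := RingQuot.mkAlgHom_surjective R r
  refine ⟨(LinearMap.ker q).liftQ f hle ∘ₗ (q.quotKerEquivOfSurjective hq).symm.toLinearMap,
    fun a => ?_⟩
  have : (q.quotKerEquivOfSurjective hq).symm (q a) = Submodule.Quotient.mk a := by
    rw [LinearEquiv.symm_apply_eq]; rfl
  exact (congrArg ((LinearMap.ker q).liftQ f hle) this).trans (Submodule.liftQ_apply _ _ _)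

end WordFunctional

/-! ### Existence and uniqueness of the trace -/

noncomputable section MarkovTrace

variable {n : ℕ} {K : Type*} [Field K] [Algebra ℤ[T;T⁻¹] K]

namespace TypeE

theorem mkAlgHom_word (ω : List (Fin n)) :
    RingQuot.mkAlgHom ℤ[T;T⁻¹] (TLRel n) (ω.map (FreeAlgebra.ι _)).prod = bWord n ω := by
  rw [map_list_prod, List.map_map]; rfl

theorem bWord_append (x y : List (Fin n)) : bWord n (x ++ y) = bWord n x * bWord n y := by
  simp [bWord]

theorem bWordK_append (x y : List (Fin n)) :
    bWordK K n (x ++ y) = bWordK K n x * bWordK K n y := by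
  rw [bWordK, bWordK, bWordK, Algebra.TensorProduct.tmul_mul_tmul, one_mul, bWord_append]

theorem b_sq (i : Fin n) : b n i * b n i = delta • b n i := by
  rw [b, ← map_mul, RingQuot.mkAlgHom_rel _ (TLRel.sq i), map_smul]

theorem b_comm {i j : Fin n} (h : ¬ Adj n i j) : b n i * b n j = b n j * b n i := by
  by_cases hij : i = j
  · rw [hij]
  rw [b, b, ← map_mul, RingQuot.mkAlgHom_rel _ (TLRel.comm i j (coxeterMatrix_not_adj h hij)),
    map_mul]

theorem b_braid {i j : Fin n} (h : Adj n i j) : b n i * b n j * b n i = b n i := by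
  rw [b, b, ← map_mul, ← map_mul, RingQuot.mkAlgHom_rel _ (TLRel.braid i j (coxeterMatrix_adj h))]

theorem bWord_congr {x y : List (Fin n)} (h : CommEq (eGraph n) x y) : bWord n x = bWord n y := by
  induction h with
  | refl x => rfl
  | swap x hab y =>
    simp only [bWord, List.map_append, List.map_cons, List.prod_append, List.prod_cons,
      ← mul_assoc (b n _) (b n _), b_comm hab]
  | trans _ _ h1 h2 => exact h1.trans h2

theorem bWordK_sq (s : Fin n) (y : List (Fin n)) :
    bWordK K n (s :: s :: y) = deltaK K • bWordK K n (s :: y) := by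
  simp only [bWordK, bWord, List.map_cons, List.prod_cons]
  rw [← mul_assoc, b_sq, smul_mul_assoc, TensorProduct.tmul_smul, deltaK, algebraMap_smul]

theorem bWordK_braid {s t : Fin n} (h : Adj n s t) (y : List (Fin n)) :
    bWordK K n (s :: t :: s :: y) = bWordK K n (s :: y) := by
  simp only [bWordK, bWord, List.map_cons, List.prod_cons]
  rw [← mul_assoc (b n t), ← mul_assoc (b n s), ← mul_assoc (b n s), b_braid h]

theorem tlk_ext {f g : TLK K n →ₗ[K] K}
    (h : ∀ ω, f (bWordK K n ω) = g (bWordK K n ω)) : f = g := by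
  refine TensorProduct.AlgebraTensorModule.curry_injective (LinearMap.ext_ring ?_)
  refine (LinearMap.cancel_right (g := (RingQuot.mkAlgHom ℤ[T;T⁻¹] (TLRel n)).toLinearMap)
    (RingQuot.mkAlgHom_surjective ℤ[T;T⁻¹] (TLRel n))).1 ?_
  refine FreeAlgebra.ext_words fun ω => ?_
  have := h ω
  rw [bWordK, ← mkAlgHom_word] at this
  exact this

theorem isTrace_of_words {f : TLK K n →ₗ[K] K} (h : ∀ x y : List (Fin n),
    f (bWordK K n (x ++ y)) = f (bWordK K n (y ++ x))) : IsTrace f := by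
  have h1 : ∀ (x : List (Fin n)) (y : TLK K n), f (bWordK K n x * y) = f (y * bWordK K n x) :=
    fun x => LinearMap.congr_fun (f := f ∘ₗ LinearMap.mulLeft K (bWordK K n x))
      (g := f ∘ₗ LinearMap.mulRight K (bWordK K n x)) (tlk_ext fun y => by
        simp only [LinearMap.comp_apply, LinearMap.mulLeft_apply, LinearMap.mulRight_apply,
          ← bWordK_append, h x y])
  exact fun x y => LinearMap.congr_fun (f := f ∘ₗ LinearMap.mulRight K y)
    (g := f ∘ₗ LinearMap.mulLeft K y) (tlk_ext fun w => by
      simp only [LinearMap.comp_apply, LinearMap.mulLeft_apply, LinearMap.mulRight_apply,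
        h1 w y]) x

theorem delta_ne_zero : delta ≠ 0 := by
  intro h
  have h1 := congrArg (fun p : ℤ[T;T⁻¹] => p.coeff 1) h
  simp [delta] at h1

theorem deltaK_ne_zero (hK : Function.Injective (algebraMap ℤ[T;T⁻¹] K)) : deltaK K ≠ 0 :=
  (map_ne_zero_iff _ hK).2 delta_ne_zero

/-- The exponents established at parameter `2` obey the relations for arbitrary `δ`. Exponents may
be negative, so `δ ^ (1 + e) = δ * δ ^ e` needs `δ ≠ 0`. -/
theorem exists_functional (hn : 6 ≤ n) (hδ : deltaK K ≠ 0) :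
    ∃ tr : TLK K n →ₗ[K] K, ∀ ω, tr (bWordK K n ω) = deltaK K ^ traceExp n ω := by
  set f : FreeAlgebra ℤ[T;T⁻¹] (Fin n) →ₗ[ℤ[T;T⁻¹]] K :=
    FreeAlgebra.wordFunctional fun ω => deltaK K ^ traceExp n ω with hf
  obtain ⟨g, hg⟩ := RingQuot.exists_linearMap (r := TLRel n) f (by
    intro a c hac
    refine FreeAlgebra.map_mul_mul_of_words fun x y => ?_
    have hw : ∀ ω, f ((x.map (FreeAlgebra.ι _)).prod * (ω.map (FreeAlgebra.ι _)).prod *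
        (y.map (FreeAlgebra.ι _)).prod) = deltaK K ^ traceExp n (x ++ (ω ++ y)) := by
      intro ω
      rw [← FreeAlgebra.wordFunctional_word (R := ℤ[T;T⁻¹])
        (fun ω => deltaK K ^ traceExp n ω) (x ++ (ω ++ y)), ← hf]
      simp only [List.map_append, List.prod_append, mul_assoc]
    cases hac with
    | sq i =>
      have h1 := hw [i, i]
      have h2 := hw [i]
      simp only [List.map_cons, List.map_nil, List.prod_cons, List.prod_nil, mul_one,
        List.cons_append, List.nil_append] at h1 h2
      rw [h1, mul_smul_comm, smul_mul_assoc, map_smul, h2, traceExp_sq hn, zpow_one_add₀ hδ,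
        deltaK, Algebra.smul_def]
    | comm i j h =>
      have h1 := hw [i, j]
      have h2 := hw [j, i]
      simp only [List.map_cons, List.map_nil, List.prod_cons, List.prod_nil, mul_one,
        List.cons_append, List.nil_append] at h1 h2
      rw [h1, h2, traceExp_congr hn (.swap x (coxeterMatrix_eq_two h) y)]
    | braid i j h =>
      have h1 := hw [i, j, i]
      have h2 := hw [i]
      simp only [List.map_cons, List.map_nil, List.prod_cons, List.prod_nil, mul_one,
        List.cons_append, List.nil_append, ← mul_assoc (FreeAlgebra.ι _ i)] at h1 h2
      rw [h1, h2, traceExp_braid hn _ _ (coxeterMatrix_eq_three h)])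
  refine ⟨TensorProduct.AlgebraTensorModule.lift
    ((LinearMap.toSpanSingleton K _ g)), fun ω => ?_⟩
  rw [bWordK, TensorProduct.AlgebraTensorModule.lift_tmul, LinearMap.toSpanSingleton_apply,
    one_smul, ← mkAlgHom_word, hg, hf, FreeAlgebra.wordFunctional_word]

theorem isMarkovTr_of_words (hn : 6 ≤ n) {tr : TLK K n →ₗ[K] K}
    (h : ∀ ω, tr (bWordK K n ω) = deltaK K ^ traceExp n ω) : IsMarkovTr tr :=
  ⟨isTrace_of_words fun x y => by rw [h, h, traceExp_append_comm hn], fun A hA => by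
    rw [h, traceExp_antichain hn (antichain_wordOf hA), length_wordOf]⟩

/-- The values on antichains propagate to all words by `word_induction`; `δ ≠ 0` enters in the
cancellation of a doubled letter. -/
theorem IsMarkovTr.unique (hn : 6 ≤ n) (hδ : deltaK K ≠ 0) {τ τ' : TLK K n →ₗ[K] K}
    (h : IsMarkovTr τ) (h' : IsMarkovTr τ') : τ = τ' := by
  refine tlk_ext fun ω => word_induction (G := eGraph n) (fcWord_append_self hn)
    (P := fun u => τ (bWordK K n u) = τ' (bWordK K n u)) ?_ ?_ ?_ ?_ ?_ ?_ ω
  · intro A hA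
    obtain ⟨S, hS, hAS⟩ := hA.exists_wordOf
    have e : bWordK K n A = bWordK K n (wordOf n S) := by rw [bWordK, bWordK, bWord_congr hAS]
    rw [e, h.2 S hS, h'.2 S hS]
  · intro x y hxy
    rwa [bWordK_append, h.1, h'.1, ← bWordK_append]
  · intro x y hxy hx
    rwa [bWordK, ← bWord_congr hxy]
  · intro s y hy
    rw [bWordK_sq, map_smul, map_smul, hy]
  · intro s t y hst hy
    rwa [bWordK_braid hst]
  · intro s y hy
    rw [bWordK_sq, map_smul, map_smul] at hy
    exact smul_right_injective K hδ hy

end TypeE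

end MarkovTrace

/-! ### Comparison with Fan's function -/

section AFunction

variable {n : ℕ}

namespace TypeE

theorem IsReducedExpression.traceExp_eq_iff (hn : 6 ≤ n) {w : W n} (hw : IsFullyCommutative n w)
    {ω : List (Fin n)} (hω : IsReducedExpression n ω w) :
    traceExp n ω ≤ -(aFun n w : ℤ) ∧ (traceExp n ω = -(aFun n w : ℤ) ↔ w ^ 2 = 1) := by
  have hfc : FCWord (eGraph n) ω := fcWord_of_isReduced hω.1 (by rwa [hω.2])
  have hrep := isTLRep_eMat hn
  have hF := fcWord_append_self hn
  -- An antichain that attains the maximum. The factorization lifts to a reduced word containing it,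
  -- which agrees with `ω` up to commutations.
  obtain ⟨A, x, y, hA, hcard, hxy, hlen⟩ := (aFun_isGreatest n w).1
  obtain ⟨α, hα, rfl⟩ := (cs n).exists_isReduced x
  obtain ⟨β, hβ, rfl⟩ := (cs n).exists_isReduced y
  have hAred := isReduced_antichain hn (antichain_wordOf hA)
  have hexpr : IsReducedExpression n (α ++ wordOf n A ++ β) w := by
    have e : (cs n).wordProd (α ++ wordOf n A ++ β) = w := by
      rw [CoxeterSystem.wordProd_append, CoxeterSystem.wordProd_append, hxy, prodOf]
    refine ⟨?_, e⟩
    rw [CoxeterSystem.IsReduced, e, hlen, prodOf, hα.eq, hβ.eq, hAred.eq, List.length_append,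
      List.length_append]
  have hc := commEq_of_isReducedExpression hn hw hω hexpr
  obtain ⟨hle, heq⟩ := hrep.ntr_antichain_le hF (antichain_wordOf hA) (hc.fcWord hfc)
  rw [length_wordOf, hcard, ← hrep.wordMat_congr hc] at hle heq
  have hle' := (two_pow_mul_ntr_le_one_iff hn).1 hle
  refine ⟨hle', fun h => ?_, fun h => ?_⟩
  · obtain ⟨z, B, hB, hp, -⟩ := hrep.exists_palindrome hF hfc
      (heq ((two_pow_mul_ntr_eq_one_iff hn).2 h))
    have hrev : CommEq (eGraph n) B.reverse B :=
      commEq_of_perm (fun a ha b hb => hB.not_adj (by simpa using ha) (by simpa using hb))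
        (List.reverse_perm B)
    have hp' : CommEq (eGraph n) ω.reverse ω := by
      refine hp.reverse.trans (CommEq.trans ?_ hp.symm)
      simpa using (hrev.append_right z.reverse).append_left z
    have := wordProd_congr hp'
    rw [CoxeterSystem.wordProd_reverse, hω.2] at this
    rw [pow_two]
    nth_rw 1 [← this]
    exact inv_mul_cancel w
  -- Since `w` is its own inverse, the reversed word is also a reduced word for it, hence equivalent
  -- to `ω` under commutations, and the matrix is symmetric.
  · have hinv : w⁻¹ = w := inv_eq_of_mul_eq_one_right (by rwa [← pow_two])
    have hrev : IsReducedExpression n ω.reverse w :=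
      ⟨hω.1.reverse, by rw [CoxeterSystem.wordProd_reverse, hω.2, hinv]⟩
    obtain ⟨z, B, hB, hp, hone⟩ := hrep.exists_palindrome hF hfc (by
      rw [← hrep.wordMat_reverse,
        hrep.wordMat_congr (commEq_of_isReducedExpression hn hw hrev hω)])
    obtain ⟨S, hS, hBS⟩ := hB.exists_wordOf
    have he := (two_pow_mul_ntr_eq_one_iff hn).1 hone
    -- The centre `B` of the palindrome competes in the maximum, so the exponent `-#B` is at least
    -- `-a(w)`, the missing inequality.
    have hmem : B.length ∈ aSet n w := by
      have hred := isReduced_congr hp hω.1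
      have hSp : prodOf n S = (cs n).wordProd B := (wordProd_congr hBS).symm
      refine ⟨S, (cs n).wordProd z, (cs n).wordProd z.reverse, hS, ?_, ?_, ?_⟩
      · rw [hBS.length_eq, length_wordOf]
      · rw [hSp, ← CoxeterSystem.wordProd_append, ← CoxeterSystem.wordProd_append,
          ← wordProd_congr hp, hω.2]
      · rw [hSp, (isReduced_left (isReduced_left hred)).eq, (isReduced_right hred).eq,
          (isReduced_right (isReduced_left hred)).eq, ← hω.2, hω.1.eq, hp.length_eq,
          List.length_append, List.length_append]
    have := (aFun_isGreatest n w).2 hmem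
    omega

end TypeE

end AFunction

theorem proposition6p3 (n : ℕ) (hn : 6 ≤ n) (K : Type*) [Field K] [Algebra ℤ[T;T⁻¹] K]
    (hK : Function.Injective (algebraMap ℤ[T;T⁻¹] K)) :
    ∃ tr : TypeE.TLK K n →ₗ[K] K,
      TypeE.IsMarkovTr tr ∧
      (∀ τ : TypeE.TLK K n →ₗ[K] K, TypeE.IsMarkovTr τ → τ = tr) ∧
      ∀ w : TypeE.W n, TypeE.IsFullyCommutative n w →
        ∃ a : ℤ,
          (∀ ω : List (Fin n), TypeE.IsReducedExpression n ω w →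
            tr (TypeE.bWordK K n ω) = TypeE.deltaK K ^ a) ∧
          (w ^ 2 = 1 → a = -(TypeE.aFun n w : ℤ)) ∧
          (w ^ 2 ≠ 1 → a < -(TypeE.aFun n w : ℤ)) := by
  have hδ := TypeE.deltaK_ne_zero hK
  obtain ⟨tr, htr⟩ := TypeE.exists_functional hn hδ
  have hM := TypeE.isMarkovTr_of_words hn htr
  refine ⟨tr, hM, fun τ hτ => hτ.unique hn hδ hM, fun w hw => ?_⟩
  obtain ⟨ω, hω, hωw⟩ := (TypeE.cs n).exists_isReduced w
  have hω' : TypeE.IsReducedExpression n ω w := ⟨hω, hωw.symm⟩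
  obtain ⟨hle, hiff⟩ := hω'.traceExp_eq_iff hn hw
  refine ⟨traceExp n ω, fun ω' h => ?_, hiff.2, fun h => lt_of_le_of_ne hle (mt hiff.1 h)⟩
  rw [htr, traceExp_congr hn (commEq_of_isReducedExpression hn hw h hω')]
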